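/- Let $x_1,\dots,x_n$ be issues with costs $c_1,\dots,c_n\in\mathbb N$ and let $B\in\mathbb N$ be a total budget. A ballot is a vector $r\in\{0,1\}^n$; it is called rational if it satisfies the budget constraint, i.e. if $\sum_{i:\,r(x_i)=1}c_i\le B$. Let $\mathcal R$ be the set of rational ballots. A profile $P=(r_1,\dots,r_p)$, $p\ge 1$, is a non-empty finite sequence of rational ballots. A partial ballot $s\in\{0,1,\star\}^n$ agrees with a ballot $r$ if $s(x)=r(x)$ whenever $s(x)\ne\star$. A ballot satisfies the literal $x$ if $r(x)=1$ and the literal $\neg x$ if $r(x)=0$. Let $d_H$ be the Hamming distance, i.e. the number of issues on which two (possibly partial) ballots differ. Consider the following judgment aggregation procedures $F$, each of which maps a profile to a set of rational ballots. * Kemeny: the $r\in\mathcal R$ that maximize $\sum_{i}\sum_{l:\,r\models l}s(r_i,l)$, where $l$ ranges over the $2n$ literals and $s(r_i,l)$ is $1$ if $r_i$ satisfies $l$ and $0$ otherwise. * Reversal scoring: the $r\in\mathcal R$ that maximize the same sum with $s(r_i,l)=\min\{d_H(r_i,r') : r'\in\mathcal R,\ r'\not\models l\}$. (If no rational ballot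 falsifies $l$, put $s(r_i,l)=0$; as $l$ is then true in all rational ballots, this value does not affect the maximizers.) * Slater: the $r\in\mathcal R$ that minimize $d_H(r,m_P)$, where $m_P(x)\in\{0,1\}$ is the value given to $x$ by a strict majority of the ballots of $P$, and $m_P(x)=\star$ if there is no strict majority. * Ranked agenda (Tideman), with respect to a tie-breaking linear order on the $2n$ literals: order the literals by decreasing number of ballots of $P$ that satisfy them, ties being broken by the tie-breaking order. Start from the empty partial ballot and go through all $2n$ literals in this order; set a literal to true if it is not already false and the resulting partial ballot agrees with some rational ballot, and leave the partial ballot unchanged otherwise. The only outcome is the ballot reached in the end. The problem $\mathrm{Outcome}(F)$ under a budget constraint is: given $c_1,\dots,c_n$, $B$, a profile $P$ and a partial ballot $s$ (and, for the ranked agenda, the tie-breaking order, as a list of the $2n$ literals), is there a ballot $r^*\in F(P)$ with which $s$ agrees? **Corollary.** For each of the four procedures, Kemeny, Slater, reversal scoring and ranked agenda, $\mathrm{Outcome}(F)$ under a budget constraint is decidable by a Turing machine in time polynomial in the length of the instance, where the costs and the budget are written in binary. -/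

import Mathlib

namespace JudgmentAggregation

open Computability

/-! ### Ballots, integrity constraints and profiles -/

/-- A (complete) ballot for the issues `x₁, …, xₙ`. -/
abbrev Ballot (n : ℕ) := Fin n → Bool

/-- A partial ballot; `none` plays the role of `⋆`. -/
abbrev PartialBallot (n : ℕ) := Fin n → Option Bool

/-- Literals: `(x, true)` is the literal `x` and `(x, false)` is the literal `¬ x`. -/
abbrev Lit (n : ℕ) := Fin n × Bool

/-- The ballot `r` makes the literal `l` true, i.e. `r(l) = 1`. -/
abbrev Sat {n : ℕ} (r : Ballot n) (l : Lit n) : Prop := r l.1 = l.2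

/-- The partial ballot `s` agrees with the ballot `r`. -/
def Agrees {n : ℕ} (s : PartialBallot n) (r : Ballot n) : Prop :=
  ∀ (x : Fin n) (b : Bool), s x = some b → r x = b

/-- An integrity constraint on `n` issues. All notions below depend on the constraint `Γ` only
through the set of rational ballots (the complete ballots that are consistent with `Γ`),
so we identify `Γ` with this set. -/
abbrev Constraint (n : ℕ) := Set (Ballot n)

/-- A sequence of ballots. (Profiles are the nonempty sequences of rational ballots.) -/
abbrev Profile (n : ℕ) := List (Ballot n)

/-! ### Judgment aggregation procedures -/

/-- The cumulative score of the literals that agree with `r`, with respect to all ballots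
of the profile. -/
def totalScore {n : ℕ} (sc : Ballot n → Lit n → ℕ) (P : Profile n) (r : Ballot n) : ℕ :=
  (P.map fun ri => ∑ l : Lit n with Sat r l, sc ri l).sum

/-- The scoring procedure of the scoring function `sc`: the rational ballots that maximize the
cumulative score. -/
def scoringRule {n : ℕ} (Γ : Constraint n) (sc : Ballot n → Lit n → ℕ) (P : Profile n) :
    Set (Ballot n) :=
  {r | r ∈ Γ ∧ ∀ r' ∈ Γ, totalScore sc P r' ≤ totalScore sc P r}

/-- The median (Kemeny) procedure, i.e. the scoring procedure for `s(r, l) = r(l)`. -/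
def kemeny {n : ℕ} (Γ : Constraint n) (P : Profile n) : Set (Ballot n) :=
  scoringRule Γ (fun r l => if Sat r l then 1 else 0) P

/-- The reversal score: the least number of issues that have to be flipped in `r` to get a
rational ballot in which `l` is false. If no rational ballot makes `l` false, the score is `0`;
such a literal is true in every rational ballot, so its score adds the same amount to the total
of every rational ballot and this convention has no influence on the procedure. -/
noncomputable def reversalScore {n : ℕ} (Γ : Constraint n) (r : Ballot n) (l : Lit n) : ℕ :=
  sInf {d | ∃ r' ∈ Γ, ¬ Sat r' l ∧ hammingDist r r' = d}

/-- The reversal scoring procedure. -/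
noncomputable def reversalScoring {n : ℕ} (Γ : Constraint n) (P : Profile n) : Set (Ballot n) :=
  scoringRule Γ (reversalScore Γ) P

/-- The majority strength of a literal: the number of ballots of the profile that satisfy it. -/
def majorityStrength {n : ℕ} (P : Profile n) (l : Lit n) : ℕ :=
  P.countP fun r => decide (Sat r l)

/-- The majority outcome, a partial ballot given by the strict majorities. -/
def majorityOutcome {n : ℕ} (P : Profile n) : PartialBallot n := fun x =>
  if P.length < 2 * majorityStrength P (x, true) then some true
  else if P.length < 2 * majorityStrength P (x, false) then some false
  else none

/-- The max-card Condorcet (Slater) procedure: the rational ballots that minimize the Hamming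
distance to the majority outcome. -/
def slater {n : ℕ} (Γ : Constraint n) (P : Profile n) : Set (Ballot n) :=
  {r | r ∈ Γ ∧ ∀ r' ∈ Γ,
    hammingDist (fun x => some (r x)) (majorityOutcome P) ≤
      hammingDist (fun x => some (r' x)) (majorityOutcome P)}

/-- `l₁` comes before `l₂` in the order of the ranked agenda procedure: higher majority strength
first, ties broken by the tie-breaking order `tb`. -/
def Precedes {n : ℕ} (tb : Lit n → Lit n → Prop) (P : Profile n) (l₁ l₂ : Lit n) : Prop :=
  majorityStrength P l₂ < majorityStrength P l₁ ∨
    majorityStrength P l₁ = majorityStrength P l₂ ∧ tb l₁ l₂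

open Classical in
/-- One step of the ranked agenda procedure: set `l` to true if `l` is not already false and the
resulting partial ballot is consistent with `Γ`. -/
noncomputable def rankedStep {n : ℕ} (Γ : Constraint n) (s : PartialBallot n) (l : Lit n) :
    PartialBallot n :=
  if s l.1 ≠ some (!l.2) ∧ ∃ r ∈ Γ, Agrees (Function.update s l.1 (some l.2)) r then
    Function.update s l.1 (some l.2)
  else s

/-- The ranked agenda (Tideman) procedure with tie-breaking order `tb` (a strict linear order on
the literals): list all literals in the order `Precedes tb P` and process them one by one,
starting from the empty partial ballot; the outcome is the ballot reached in the end. -/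
def rankedAgenda {n : ℕ} (tb : Lit n → Lit n → Prop) (Γ : Constraint n) (P : Profile n) :
    Set (Ballot n) :=
  {r | ∃ L : List (Lit n), (∀ l, l ∈ L) ∧ L.Pairwise (Precedes tb P) ∧
    L.foldl (rankedStep Γ) (fun _ => none) = fun x => some (r x)}

/-- The question of outcome determination: does some ballot among the collective outcomes
agree with the partial ballot `s`? -/
def OutcomeQuestion {n : ℕ} (outcomes : Set (Ballot n)) (s : PartialBallot n) : Prop :=
  ∃ r ∈ outcomes, Agrees s r

/-! ### Budget constraints -/

/-- The budget constraint for the costs `c` and the budget `B`: a ballot is rational iff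
the issues that it sets to true cost at most `B` in total. -/
def budgetConstraint {n : ℕ} (c : Fin n → ℕ) (B : ℕ) : Constraint n :=
  {r | ∑ x : Fin n with r x = true, c x ≤ B}

/-- An instance of outcome determination under a budget constraint. -/
structure BudgetInstance where
  /-- the number of issues -/
  numIssues : ℕ
  /-- the implementation costs of the issues -/
  cost : Fin numIssues → ℕ
  /-- the total budget -/
  budget : ℕ
  /-- the ballots of the individuals -/
  profile : Profile numIssues
  profile_ne_nil : profile ≠ []
  profile_rational : ∀ r ∈ profile, r ∈ budgetConstraint cost budget
  /-- the partial ballot that the collective outcome is asked to agree with -/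
  target : PartialBallot numIssues

/-- The integrity constraint of an instance. -/
def BudgetInstance.constraint (I : BudgetInstance) : Constraint I.numIssues :=
  budgetConstraint I.cost I.budget

/-- An instance for the ranked agenda procedure also has a tie-breaking order on the literals,
given by enumerating them from the first to the last. -/
structure RankedBudgetInstance extends BudgetInstance where
  /-- `tieBreak i` is the literal in position `i` of the tie-breaking order -/
  tieBreak : Fin (2 * numIssues) ≃ Lit numIssues

/-- The tie-breaking order of an instance. -/
def RankedBudgetInstance.tb (I : RankedBudgetInstance) (l₁ l₂ : Lit I.numIssues) : Prop :=
  I.tieBreak.symm l₁ < I.tieBreak.symm l₂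

/-! ### Instances as words over the finite alphabet `Γ'` (blank, bits, brackets, comma) -/

/-- Natural numbers are written in binary and followed by a comma. -/
def encodeNumber (m : ℕ) : List Γ' := (encodeNat m).map Γ'.bit ++ [Γ'.comma]

/-- Ballots are written as bit vectors and followed by a comma. -/
def encodeBallot {n : ℕ} (r : Ballot n) : List Γ' := (List.ofFn r).map Γ'.bit ++ [Γ'.comma]

/-- Partial ballots are written like ballots, with a blank for an undecided issue. -/
def encodePartialBallot {n : ℕ} (s : PartialBallot n) : List Γ' :=
  (List.ofFn s).map (fun o => o.elim Γ'.blank Γ'.bit) ++ [Γ'.comma]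

/-- A literal is written as its sign and the number of its issue. -/
def encodeLit {n : ℕ} (l : Lit n) : List Γ' := Γ'.bit l.2 :: encodeNumber l.1

/-- A list is written by enclosing the codes of its entries in brackets. -/
def encodeSeq {α : Type} (e : α → List Γ') (L : List α) : List Γ' :=
  Γ'.bra :: (L.flatMap e ++ [Γ'.ket])

/-- An instance is written as its budget, its costs, its profile and its partial ballot. -/
def BudgetInstance.encode (I : BudgetInstance) : List Γ' :=
  encodeNumber I.budget ++ encodeSeq encodeNumber (List.ofFn I.cost) ++
    encodeSeq encodeBallot I.profile ++ encodePartialBallot I.target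

/-- For the ranked agenda procedure, the tie-breaking order is appended. -/
def RankedBudgetInstance.encode (I : RankedBudgetInstance) : List Γ' :=
  I.toBudgetInstance.encode ++ encodeSeq encodeLit (List.ofFn I.tieBreak)

/-! ### Polynomial-time decidability -/

/-- The decision problem `Q` on the instances in `α`, written as words by `enc`, is decided by a
Turing machine in time polynomial in the length of the word. -/
def PolyTimeDecidable {α A : Type} (enc : α → List A) (Q : α → Prop) : Prop :=
  ∃ f : α → Bool, (∀ a, f a = true ↔ Q a) ∧
    Nonempty (Turing.TM2ComputableInPolyTime enc encodeBool f)

end JudgmentAggregation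

/-!
The proof has two parts: polynomial-time algorithms for the four procedures, and a way to turn
algorithms that are written as functions on lists into Turing machines.

**Algorithms.** Under a budget constraint, all four procedures reduce to one question: given
weights `w x b` for the values `b` of the issues `x`, a partial ballot `s` and a number `v`, is
there a rational ballot of total weight `v` with which `s` agrees? This is a knapsack problem whose
costs are binary numbers but whose weights are small, so it is solved by the dynamic program that
computes, for each weight `v`, the least cost of a choice of weight `v`
(`JudgmentAggregation.knapsack`, `JudgmentAggregation.feasible_iff`).

* Every scoring procedure maximizes a sum of weights of the single issues (`totalScore_eq`). So
  `s` agrees with an outcome iff for some `v` there is a rational ballot of weight `v` with which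
  `s` agrees but no rational ballot of larger weight (`optimal_iff`). This covers the Kemeny
  procedure and, as the distance to the majority outcome is the number of issues minus such a sum,
  the Slater procedure.
* A reversal score is itself the least weight of a rational ballot with a given value of one issue,
  where a value has weight `1` if it differs from the one in the given ballot (`reversalBits_eq`).
* A step of the ranked agenda procedure asks whether some rational ballot agrees with a partial
  ballot, which is the question above for the weights `0` (`agendaStep_eq`). The agenda is found
  by going through the possible majority strengths in decreasing order (`eq_of_pairwise_precedes`
  shows that there is no other agenda).

**Turing machines.** Structured programs on stacks (`StackProgram.Prog`) compile to the machines of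
Mathlib, one machine step for each instruction (`StackProgram.Exec.evalsTo`). All data are coded by
binary trees; a tree in prefix notation is self-delimiting, so that a single stack can hold all the
intermediate values of a computation. A function is in `StackProgram.PolyTime` if some program
replaces its argument on top of that stack by its value, in polynomially many steps and whatever is
below. This class is closed under composition, pairing, case distinctions and those loops over lists
whose intermediate values are of polynomial size (`StackProgram.PolyTime.foldl`), which is enough
to write the algorithms, and the reading of an instance, as ordinary functions on lists.
-/

namespace StackProgram

open Turing StateTransition

/-! ### Structured stack programs and their compilation to Turing machines -/

/-- Structured programs over a family of stacks with alphabets `Γ`. -/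
inductive Prog {K : Type} (Γ : K → Type) : Type
  /-- do nothing -/
  | skip : Prog Γ
  /-- push a fixed symbol -/
  | push (k : K) (a : Γ k) : Prog Γ
  /-- sequential composition -/
  | seq (p q : Prog Γ) : Prog Γ
  /-- pop a symbol and continue according to the symbol, or to the stack having been empty -/
  | case (k : K) (p₀ : Prog Γ) (p : Γ k → Prog Γ) : Prog Γ
  /-- pop symbols and run the body for each of them, until the stack is found empty -/
  | loop (k : K) (p : Γ k → Prog Γ) : Prog Γ

variable {K : Type} {Γ : K → Type}

/-- The labels of the compiled program: one for each of its instructions. -/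
def Prog.Label : Prog Γ → Type
  | .skip => Unit
  | .push _ _ => Unit
  | .seq p q => p.Label ⊕ q.Label
  | .case _ p₀ p => Option (p₀.Label ⊕ Σ a, (p a).Label)
  | .loop _ p => Option (Σ a, (p a).Label)

instance Prog.finite_label [∀ k, Finite (Γ k)] (p : Prog Γ) : Finite p.Label := by
  induction p with
  | skip => exact inferInstanceAs (Finite Unit)
  | push => exact inferInstanceAs (Finite Unit)
  | seq p q _ _ => exact inferInstanceAs (Finite (p.Label ⊕ q.Label))
  | case k p₀ p _ _ => exact inferInstanceAs (Finite (Option (p₀.Label ⊕ Σ a, (p a).Label)))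
  | loop k p _ => exact inferInstanceAs (Finite (Option (Σ a, (p a).Label)))

/-- The label of the first instruction. -/
def Prog.entry : (p : Prog Γ) → p.Label
  | .skip => ()
  | .push _ _ => ()
  | .seq p _ => Sum.inl p.entry
  | .case _ _ _ => (none : Option _)
  | .loop _ _ => (none : Option _)

variable [DecidableEq K]

/-- The compiled program, for an embedding `e` of its labels into the labels of an ambient machine;
the label `x` is where the execution continues afterwards. The internal state of the machine
remembers the symbol that was last popped from each stack. -/
def Prog.compile : (p : Prog Γ) → {Λ : Type} → (p.Label → Λ) → Λ → p.Label →
    TM2.Stmt Γ Λ (∀ k, Option (Γ k))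
  | .skip, _, _, x, _ => .goto fun _ => x
  | .push k a, _, _, x, _ => .push k (fun _ => a) (.goto fun _ => x)
  | .seq p q, _, e, _, .inl l => p.compile (fun l => e (.inl l)) (e (.inr q.entry)) l
  | .seq _ q, _, e, x, .inr l => q.compile (fun l => e (.inr l)) x l
  | .case k p₀ p, _, e, _, none => .pop k (fun v o => Function.update v k o) (.goto fun v =>
      match v k with
      | none => e (some (.inl p₀.entry))
      | some a => e (some (.inr ⟨a, (p a).entry⟩)))
  | .case _ p₀ _, _, e, x, some (.inl l) => p₀.compile (fun l => e (some (.inl l))) x l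
  | .case _ _ p, _, e, x, some (.inr ⟨a, l⟩) =>
      (p a).compile (fun l => e (some (.inr ⟨a, l⟩))) x l
  | .loop k p, _, e, x, none => .pop k (fun v o => Function.update v k o) (.goto fun v =>
      match v k with
      | none => x
      | some a => e (some ⟨a, (p a).entry⟩))
  | .loop _ p, _, e, _, some ⟨a, l⟩ => (p a).compile (fun l => e (some ⟨a, l⟩)) (e none) l

/-- `Exec p S S' n`: started on the stacks `S`, the program `p` ends with the stacks `S'`
after at most `n` machine steps. -/
inductive Exec : Prog Γ → (∀ k, List (Γ k)) → (∀ k, List (Γ k)) → ℕ → Prop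
  | skip (S) : Exec .skip S S 1
  | push (S) (k a) : Exec (.push k a) S (Function.update S k (a :: S k)) 1
  | seq {p q S₁ S₂ S₃ m n} (hp : Exec p S₁ S₂ m) (hq : Exec q S₂ S₃ n) :
      Exec (.seq p q) S₁ S₃ (m + n)
  | case_nil {k p₀ p S S' n} (hk : S k = []) (h : Exec p₀ S S' n) :
      Exec (.case k p₀ p) S S' (n + 1)
  | case_cons {k p₀ S S' n} {p : Γ k → Prog Γ} {a l} (hk : S k = a :: l)
      (h : Exec (p a) (Function.update S k l) S' n) : Exec (.case k p₀ p) S S' (n + 1)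
  | loop_nil {k S} {p : Γ k → Prog Γ} (hk : S k = []) : Exec (.loop k p) S S 1
  | loop_cons {k S S' S'' m n} {p : Γ k → Prog Γ} {a l} (hk : S k = a :: l)
      (h : Exec (p a) (Function.update S k l) S' m) (h' : Exec (.loop k p) S' S'' n) :
      Exec (.loop k p) S S'' (m + n + 1)
  | mono {p S S' m n} (h : Exec p S S' m) (hmn : m ≤ n) : Exec p S S' n

/-- One machine step followed by a run. -/
def _root_.StateTransition.EvalsToInTime.cons {σ : Type*} {f : σ → Option σ} {a b : σ}
    {c : Option σ} {n : ℕ} (h : f a = some b) (h' : EvalsToInTime f b c n) :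
    EvalsToInTime f a c (n + 1) :=
  EvalsToInTime.trans f 1 n a b c ⟨⟨1, h⟩, le_rfl⟩ h'

/-- The compiled program does what the program does, in any machine that contains it. -/
theorem Exec.evalsTo {p : Prog Γ} {S S' : ∀ k, List (Γ k)} {n : ℕ} (h : Exec p S S' n) {Λ : Type}
    (M : Λ → TM2.Stmt Γ Λ (∀ k, Option (Γ k))) (e : p.Label → Λ) (x : Λ)
    (hM : ∀ l, M (e l) = p.compile e x l) (v : ∀ k, Option (Γ k)) :
    ∃ v', Nonempty (EvalsToInTime (TM2.step M) ⟨some (e p.entry), v, S⟩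
      (some ⟨some x, v', S'⟩) n) := by
  induction h generalizing Λ v with
  | skip S =>
    have hl := hM ()
    simp only [Prog.compile] at hl
    exact ⟨v, ⟨⟨1, by simp [flip, TM2.step, Prog.entry, hl]⟩, le_rfl⟩⟩
  | push S k a =>
    have hl := hM ()
    simp only [Prog.compile] at hl
    exact ⟨v, ⟨⟨1, by simp [flip, TM2.step, Prog.entry, hl]⟩, le_rfl⟩⟩
  | @seq p q S₁ S₂ S₃ m n hp hq ihp ihq =>
    obtain ⟨v₁, ⟨h₁⟩⟩ := ihp M (fun l => e (.inl l)) (e (.inr q.entry)) (fun l => hM (.inl l)) v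
    obtain ⟨v₂, ⟨h₂⟩⟩ := ihq M (fun l => e (.inr l)) x (fun l => hM (.inr l)) v₁
    exact ⟨v₂, ⟨add_comm n m ▸ h₁.trans _ _ _ _ _ _ h₂⟩⟩
  | @case_nil k p₀ p S S' n hk _ ih =>
    obtain ⟨v₁, ⟨h₁⟩⟩ := ih M (fun l => e (some (.inl l))) x (fun l => hM (some (.inl l)))
      (Function.update v k none)
    refine ⟨v₁, ⟨EvalsToInTime.cons ?_ h₁⟩⟩
    have hS : Function.update S k [] = S := by rw [← hk, Function.update_eq_self]
    have hl := hM none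
    simp only [Prog.compile] at hl
    simp [TM2.step, Prog.entry, hl, hk, hS]
  | @case_cons k p₀ S S' n p a l hk _ ih =>
    obtain ⟨v₁, ⟨h₁⟩⟩ := ih M (fun l => e (some (.inr ⟨a, l⟩))) x
      (fun l => hM (some (.inr ⟨a, l⟩))) (Function.update v k (some a))
    refine ⟨v₁, ⟨EvalsToInTime.cons ?_ h₁⟩⟩
    have hl := hM none
    simp only [Prog.compile] at hl
    simp [TM2.step, Prog.entry, hl, hk]
  | @loop_nil k S p hk =>
    refine ⟨Function.update v k none, ⟨⟨1, ?_⟩, le_rfl⟩⟩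
    have hS : Function.update S k [] = S := by rw [← hk, Function.update_eq_self]
    have hl := hM none
    simp only [Prog.compile] at hl
    simp [flip, TM2.step, Prog.entry, hl, hk, hS]
  | @loop_cons k S S' S'' m n p a l hk _ _ ih ih' =>
    obtain ⟨v₁, ⟨h₁⟩⟩ := ih M (fun l => e (some ⟨a, l⟩)) (e none) (fun l => hM (some ⟨a, l⟩))
      (Function.update v k (some a))
    obtain ⟨v₂, ⟨h₂⟩⟩ := ih' M e x hM v₁
    refine ⟨v₂, ⟨EvalsToInTime.cons ?_ (add_comm n m ▸ h₁.trans _ _ _ _ _ _ h₂)⟩⟩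
    have hl := hM none
    simp only [Prog.compile] at hl
    simp [TM2.step, Prog.entry, hl, hk]
  | mono h hmn ih =>
    obtain ⟨v', ⟨h'⟩⟩ := ih M e x hM v
    exact ⟨v', ⟨⟨h'.toEvalsTo, h'.steps_le_m.trans hmn⟩⟩⟩

/-- The machine that runs the program `p`, with input stack `k₀` and output stack `k₁`. The
additional label `none` resets the internal state and halts. -/
noncomputable def Prog.machine [Fintype K] [∀ k, Fintype (Γ k)] (p : Prog Γ) (k₀ k₁ : K) :
    FinTM2 where
  K := K
  k₀ := k₀
  k₁ := k₁
  Γ := Γ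
  Λ := Option p.Label
  main := some p.entry
  ΛFin := Fintype.ofFinite _
  σ := ∀ k, Option (Γ k)
  initialState := fun _ => none
  σFin := Fintype.ofFinite _
  m
    | none => .load (fun _ _ => none) .halt
    | some l => p.compile some none l

/-- The initial and final stacks of a machine, as functions. -/
theorem dite_eq_update (k₀ : K) (s : List (Γ k₀)) (k : K) :
    (if h : k = k₀ then (by rw [h]; exact s : List (Γ k)) else []) =
      Function.update (fun _ => []) k₀ s k := by
  by_cases hk : k = k₀
  · subst hk
    simp
  · rw [Function.update_of_ne hk, dif_neg hk]

/-- If the program `p` computes `f` in polynomial time, so does its machine. -/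
theorem Prog.polyTime_of_exec [Fintype K] [∀ k, Fintype (Γ k)] (p : Prog Γ) (k₀ k₁ : K) {α β : Type}
    {A B : Type} (ea : α → List A) (eb : β → List B) (f : α → β) (eA : Γ k₀ ≃ A) (eB : Γ k₁ ≃ B)
    (q : Polynomial ℕ)
    (h : ∀ x, Exec p (Function.update (fun _ => []) k₀ ((ea x).map eA.symm))
      (Function.update (fun _ => []) k₁ ((eb (f x)).map eB.symm)) (q.eval (ea x).length)) :
    Nonempty (TM2ComputableInPolyTime ea eb f) := by
  refine ⟨⟨⟨p.machine k₀ k₁, eA, eB⟩, q + 1, fun x => Nonempty.some ?_⟩⟩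
  obtain ⟨v, ⟨h'⟩⟩ := (h x).evalsTo (Λ := Option p.Label) (p.machine k₀ k₁).m some none
    (fun l => rfl) (fun _ => none)
  have hlast : EvalsToInTime (TM2.step (p.machine k₀ k₁).m)
      ⟨some none, v, Function.update (fun _ => []) k₁ ((eb (f x)).map eB.symm)⟩
      (some ⟨none, fun _ => none,
        Function.update (fun _ => []) k₁ ((eb (f x)).map eB.symm)⟩) 1 := ⟨⟨1, rfl⟩, le_rfl⟩
  have key := h'.trans _ _ _ _ _ _ hlast
  have h₁ : initList (p.machine k₀ k₁) ((ea x).map eA.symm) = ⟨some (some p.entry), fun _ => none,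
      Function.update (fun _ => []) k₀ ((ea x).map eA.symm)⟩ := by
    unfold initList
    congr 1
    funext k
    exact dite_eq_update k₀ _ k
  have h₂ : haltList (p.machine k₀ k₁) ((eb (f x)).map eB.symm) = ⟨none, fun _ => none,
      Function.update (fun _ => []) k₁ ((eb (f x)).map eB.symm)⟩ := by
    unfold haltList
    congr 1
    funext k
    exact dite_eq_update k₁ _ k
  change Nonempty (TM2OutputsInTime (p.machine k₀ k₁) ((ea x).map eA.symm)
    (some ((eb (f x)).map eB.symm)) ((q + 1).eval (ea x).length))
  unfold TM2OutputsInTime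
  rw [h₁, Option.map_some, h₂, Polynomial.eval_add, Polynomial.eval_one, add_comm]
  exact ⟨key⟩

end StackProgram

namespace StackProgram

open Turing Computability

/-! ### Binary trees on a stack -/

/-- Binary trees, the universal data type of the programs below. -/
inductive DataTree
  | nil
  | cons (a b : DataTree)

/-- The tree in prefix notation. The code is self-delimiting, so that one stack can hold a
sequence of trees. -/
def DataTree.word : DataTree → List Bool
  | .nil => [false]
  | .cons a b => true :: (a.word ++ b.word)

/-- The stacks over `Bool`: `main` holds the data, while `a`, `b` and `c` are auxiliary and empty
between two instructions on trees. -/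
inductive Aux
  | main | a | b | c
  deriving DecidableEq

instance : Fintype Aux := ⟨{.main, .a, .b, .c}, fun x => by cases x <;> simp⟩

/-- The alphabets: the stack `none` holds the input. -/
abbrev Sym : Option Aux → Type
  | none => Γ'
  | some _ => Bool

instance (k : Option Aux) : Fintype (Sym k) :=
  match k with
  | none => inferInstanceAs (Fintype Γ')
  | some _ => inferInstanceAs (Fintype Bool)

/-- The stacks with the contents `I` (input), `M` (main), `A`, `B` and `C`. -/
def st (I : List Γ') (M A B C : List Bool) : ∀ k, List (Sym k)
  | none => I
  | some .main => M
  | some .a => A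
  | some .b => B
  | some .c => C

/-- The stacks between two instructions on trees, with the contents `M` of the main stack. -/
abbrev mainSt (M : List Bool) : ∀ k, List (Sym k) := st [] M [] [] []

section
variable (I I' : List Γ') (M A B C X : List Bool)

@[simp] theorem st_main : st I M A B C (some .main) = M := rfl
@[simp] theorem st_a : st I M A B C (some .a) = A := rfl
@[simp] theorem st_b : st I M A B C (some .b) = B := rfl
@[simp] theorem st_c : st I M A B C (some .c) = C := rfl

@[simp] theorem update_st_none :
    Function.update (st I M A B C) none I' = st I' M A B C := by
  funext k; rcases k with _ | _ | _ <;> rfl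
@[simp] theorem update_st_main :
    Function.update (st I M A B C) (some .main) X = st I X A B C := by
  funext k; rcases k with _ | _ | _ <;> rfl
@[simp] theorem update_st_a :
    Function.update (st I M A B C) (some .a) X = st I M X B C := by
  funext k; rcases k with _ | _ | _ <;> rfl
@[simp] theorem update_st_b :
    Function.update (st I M A B C) (some .b) X = st I M A X C := by
  funext k; rcases k with _ | _ | _ <;> rfl
@[simp] theorem update_st_c :
    Function.update (st I M A B C) (some .c) X = st I M A B X := by
  funext k; rcases k with _ | _ | _ <;> rfl

theorem exec_push_main (s : Bool) :
    Exec (.push (some .main) s) (st I M A B C) (st I (s :: M) A B C) 1 := by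
  simpa using Exec.push (st I M A B C) (some .main) s
theorem exec_push_a (s : Bool) :
    Exec (.push (some .a) s) (st I M A B C) (st I M (s :: A) B C) 1 := by
  simpa using Exec.push (st I M A B C) (some .a) s
theorem exec_push_b (s : Bool) :
    Exec (.push (some .b) s) (st I M A B C) (st I M A (s :: B) C) 1 := by
  simpa using Exec.push (st I M A B C) (some .b) s
theorem exec_push_c (s : Bool) :
    Exec (.push (some .c) s) (st I M A B C) (st I M A B (s :: C)) 1 := by
  simpa using Exec.push (st I M A B C) (some .c) s

variable {I M A B C}

theorem exec_pop {s : Bool} {p₀ : Prog Sym} {p : Bool → Prog Sym} {S' n}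
    (h : Exec (p s) (st I M A B C) S' n) :
    Exec (.case (some .main) p₀ p) (st I (s :: M) A B C) S' (n + 1) :=
  Exec.case_cons (a := s) (l := M) rfl (by simpa using h)

theorem exec_loop_c {s : Bool} {p : Bool → Prog Sym} {S' S'' m n}
    (h : Exec (p s) (st I M A B C) S' m) (h' : Exec (.loop (some .c) p) S' S'' n) :
    Exec (.loop (some .c) p) (st I M A B (s :: C)) S'' (m + n + 1) :=
  Exec.loop_cons (a := s) (l := C) rfl (by simpa using h) h'

theorem exec_loop_c_nil {p : Bool → Prog Sym} :
    Exec (.loop (some .c) p) (st I M A B []) (st I M A B []) 1 :=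
  Exec.loop_nil rfl

end

/-! ### Instructions on trees -/

/-- The body of the loop of `take`. -/
def takeStep (d : Aux) : Prog Sym :=
  .case (some .main) .skip fun s => .seq (.push (some d) s)
    (if s = true then .seq (.push (some .c) true) (.push (some .c) true) else .skip)

/-- Move the tree on top of the main stack, reversed, to the stack `d`; the stack `c` counts the
subtrees that are still to be read. -/
def take (d : Aux) : Prog Sym := .seq (.push (some .c) true) (.loop (some .c) fun _ => takeStep d)

/-- One of the stacks `a` and `b`. -/
def side : Bool → Aux
  | true => .a
  | false => .b

/-- The stacks with contents `X` of `side d` and `Y` of the other one of `a` and `b`. -/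
def sideSt (d : Bool) (M X Y C : List Bool) : ∀ k, List (Sym k) :=
  if d = true then st [] M X Y C else st [] M Y X C

theorem exec_takeStep_false (d : Bool) (M X Y C : List Bool) :
    Exec (takeStep (side d)) (sideSt d (false :: M) X Y C) (sideSt d M (false :: X) Y C) 3 := by
  cases d
  · exact exec_pop (.seq (exec_push_b ..) (.skip _))
  · exact exec_pop (.seq (exec_push_a ..) (.skip _))

theorem exec_takeStep_true (d : Bool) (M X Y C : List Bool) :
    Exec (takeStep (side d)) (sideSt d (true :: M) X Y C)
      (sideSt d M (true :: X) Y (true :: true :: C)) 4 := by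
  cases d
  · exact exec_pop (.seq (exec_push_b ..) (.seq (exec_push_c ..) (exec_push_c ..)))
  · exact exec_pop (.seq (exec_push_a ..) (.seq (exec_push_c ..) (exec_push_c ..)))

/-- The loop of `take` reads one tree for each symbol on the stack `c`. -/
theorem exec_take_loop (d : Bool) (t : DataTree) (R X Y C : List Bool) {S' n}
    (h : Exec (.loop (some .c) fun _ => takeStep (side d))
      (sideSt d R (t.word.reverse ++ X) Y C) S' n) :
    Exec (.loop (some .c) fun _ => takeStep (side d))
      (sideSt d (t.word ++ R) X Y (true :: C)) S' (n + 5 * t.word.length) := by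
  have hc : ∀ {M X S₁ S₂ m n}, Exec (takeStep (side d)) (sideSt d M X Y C) S₁ m →
      Exec (.loop (some .c) fun _ => takeStep (side d)) S₁ S₂ n →
      Exec (.loop (some .c) fun _ => takeStep (side d)) (sideSt d M X Y (true :: C)) S₂
        (m + n + 1) := by
    intro M X S₁ S₂ m n h₁ h₂
    cases d <;> exact exec_loop_c (p := fun _ => takeStep _) h₁ h₂
  induction t generalizing R X C n with
  | nil =>
    exact (hc (exec_takeStep_false ..) h).mono (by simp [DataTree.word]; omega)
  | cons l r ihl ihr =>
    have h₁ := ihl (r.word ++ R) (true :: X) (true :: C) (ihr R _ C (by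
      simpa [DataTree.word] using h) (fun h₁ h₂ => by
        cases d <;> exact exec_loop_c (p := fun _ => takeStep _) h₁ h₂)) (fun h₁ h₂ => by
        cases d <;> exact exec_loop_c (p := fun _ => takeStep _) h₁ h₂)
    simp only [DataTree.word, List.cons_append, List.append_assoc]
    exact (hc (exec_takeStep_true ..) h₁).mono (by simp; omega)

theorem exec_take (d : Bool) (t : DataTree) (R X Y : List Bool) :
    Exec (take (side d)) (sideSt d (t.word ++ R) X Y []) (sideSt d R (t.word.reverse ++ X) Y [])
      (5 * t.word.length + 2) := by
  refine (Exec.seq ?_ (exec_take_loop d t R X Y [] (n := 1) ?_)).mono (m := _ + (_ + _))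
    (by rw [add_comm 1 (_ + _)]; omega)
  · cases d <;> exact exec_push_c ..
  · cases d <;> exact exec_loop_c_nil

/-- Pour the contents of the stack `k` onto the stack `k'`, which reverses it. -/
def pour (k k' : Aux) : Prog Sym := .loop (some k) fun s => .push (some k') s

theorem exec_pour_a_main (M A B : List Bool) :
    Exec (pour .a .main) (st [] M A B []) (st [] (A.reverse ++ M) [] B []) (2 * A.length + 1) := by
  induction A generalizing M with
  | nil => exact .loop_nil rfl
  | cons s A ih =>
    have h := Exec.loop_cons (k := some Aux.a) (p := fun s => .push (some .main) s) (a := s)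
      (l := A) (S := st [] M (s :: A) B []) rfl
      (by rw [update_st_a]; exact exec_push_main ..) (ih _)
    simp only [List.reverse_cons, List.append_assoc, List.cons_append, List.nil_append]
    exact h.mono (by simp; omega)

theorem exec_pour_b_main (M A B : List Bool) :
    Exec (pour .b .main) (st [] M A B []) (st [] (B.reverse ++ M) A [] []) (2 * B.length + 1) := by
  induction B generalizing M with
  | nil => exact .loop_nil rfl
  | cons s B ih =>
    have h := Exec.loop_cons (k := some Aux.b) (p := fun s => .push (some .main) s) (a := s)
      (l := B) (S := st [] M A (s :: B) []) rfl
      (by rw [update_st_b]; exact exec_push_main ..) (ih _)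
    simp only [List.reverse_cons, List.append_assoc, List.cons_append, List.nil_append]
    exact h.mono (by simp; omega)

theorem exec_pour_b_a (M A B : List Bool) :
    Exec (pour .b .a) (st [] M A B []) (st [] M (B.reverse ++ A) [] []) (2 * B.length + 1) := by
  induction B generalizing A with
  | nil => exact .loop_nil rfl
  | cons s B ih =>
    have h := Exec.loop_cons (k := some Aux.b) (p := fun s => .push (some .a) s) (a := s) (l := B)
      (S := st [] M A (s :: B) []) rfl (by rw [update_st_b]; exact exec_push_a ..) (ih _)
    simp only [List.reverse_cons, List.append_assoc, List.cons_append, List.nil_append]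
    exact h.mono (by simp; omega)

/-- Remove the tree on top of the main stack. -/
def drop : Prog Sym := .seq (take .a) (.loop (some .a) fun _ => .skip)

theorem exec_drop (t : DataTree) (R : List Bool) :
    Exec drop (mainSt (t.word ++ R)) (mainSt R) (7 * t.word.length + 3) := by
  have h (A : List Bool) : Exec (.loop (some .a) fun _ => .skip) (st [] R A [] []) (mainSt R)
      (2 * A.length + 1) := by
    induction A with
    | nil => exact .loop_nil rfl
    | cons s A ih =>
      exact (Exec.loop_cons (k := some Aux.a) (p := fun _ => .skip) (a := s) (l := A) (m := 1)
        (S := st [] R (s :: A) [] []) rfl (by rw [update_st_a]; exact .skip _) ih).mono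
        (by simp; omega)
  exact (Exec.seq (exec_take true t R [] []) (h _)).mono (by simp; omega)

/-- Exchange the two trees on top of the main stack. -/
def swap : Prog Sym :=
  .seq (take .a) (.seq (take .b) (.seq (pour .a .main) (pour .b .main)))

theorem exec_swap (t u : DataTree) (R : List Bool) :
    Exec swap (mainSt (t.word ++ (u.word ++ R))) (mainSt (u.word ++ (t.word ++ R)))
      (7 * (t.word.length + u.word.length) + 6) := by
  have h := Exec.seq (exec_take true t (u.word ++ R) [] []) (Exec.seq
    (exec_take false u R [] (t.word.reverse ++ [])) (Exec.seq (exec_pour_a_main R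
      (t.word.reverse ++ []) (u.word.reverse ++ [])) (exec_pour_b_main _ _ _)))
  simp only [List.append_nil, List.reverse_reverse, List.length_reverse] at h
  exact h.mono (by omega)

/-- Duplicate the tree on top of the main stack. -/
def dup : Prog Sym :=
  .seq (take .a) (.seq (.loop (some .a) fun s => .seq (.push (some .main) s) (.push (some .b) s))
    (.seq (pour .b .a) (pour .a .main)))

theorem exec_dup (t : DataTree) (R : List Bool) :
    Exec dup (mainSt (t.word ++ R)) (mainSt (t.word ++ (t.word ++ R)))
      (12 * t.word.length + 5) := by
  have h (M A B : List Bool) :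
      Exec (.loop (some .a) fun s => .seq (.push (some .main) s) (.push (some .b) s))
        (st [] M A B []) (st [] (A.reverse ++ M) [] (A.reverse ++ B) []) (3 * A.length + 1) := by
    induction A generalizing M B with
    | nil => exact .loop_nil rfl
    | cons s A ih =>
      have h := Exec.loop_cons (k := some Aux.a)
        (p := fun s => .seq (.push (some .main) s) (.push (some .b) s)) (a := s) (l := A)
        (S := st [] M (s :: A) B []) rfl
        (by rw [update_st_a]; exact .seq (exec_push_main ..) (exec_push_b ..)) (ih _ _)
      simp only [List.reverse_cons, List.append_assoc, List.cons_append, List.nil_append]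
      exact h.mono (by simp; omega)
  have h' := Exec.seq (exec_take true t R [] []) (Exec.seq (h R (t.word.reverse ++ []) [])
    (Exec.seq (exec_pour_b_a _ _ _) (exec_pour_a_main _ _ _)))
  simp only [List.append_nil, List.reverse_reverse, List.length_reverse] at h'
  exact h'.mono (by omega)

/-- Push a word, its first symbol ending on top. -/
def pushWord : List Bool → Prog Sym
  | [] => .skip
  | s :: w => .seq (pushWord w) (.push (some .main) s)

theorem exec_pushWord (I : List Γ') (w R : List Bool) :
    Exec (pushWord w) (st I R [] [] []) (st I (w ++ R) [] [] []) (w.length + 1) := by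
  induction w with
  | nil => exact .skip _
  | cons s w ih => exact ih.seq (exec_push_main ..)

end StackProgram

namespace StackProgram

open Turing Computability

/-! ### Polynomial-time functions on data coded by trees -/

/-- Data coded by binary trees. -/
class TreeCode (α : Type) where
  /-- the tree that codes a value -/
  code : α → DataTree

/-- The code of a value as a word. -/
def word {α : Type} [TreeCode α] (x : α) : List Bool := (TreeCode.code x).word

/-- The size of a value: the length of its code. -/
def size {α : Type} [TreeCode α] (x : α) : ℕ := (word x).length

section instances

variable {α β : Type} [TreeCode α] [TreeCode β]

instance : TreeCode Unit := ⟨fun _ => .nil⟩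
instance : TreeCode Bool := ⟨fun b => if b then .cons .nil .nil else .nil⟩
instance : TreeCode (Option α) := ⟨fun o => o.elim .nil fun x => .cons .nil (TreeCode.code x)⟩
instance : TreeCode (α × β) := ⟨fun x => .cons (TreeCode.code x.1) (TreeCode.code x.2)⟩
instance : TreeCode (List α) := ⟨fun l => l.foldr (fun x t => .cons (TreeCode.code x) t) .nil⟩

/-- Natural numbers are coded in unary. -/
instance : TreeCode ℕ := ⟨fun n => TreeCode.code (List.replicate n ())⟩

/-- Symbols are coded by whether they are a comma, whether they are a bracket, and by the entry of
a partial ballot that they stand for otherwise. -/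
instance : TreeCode Γ' := ⟨fun a => TreeCode.code <| match a with
  | .comma => (true, false, (none : Option Bool))
  | .bra => (false, true, none)
  | .ket => (false, true, none)
  | .blank => (false, false, none)
  | .bit b => (false, false, some b)⟩

@[simp] theorem word_some (x : α) : word (some x) = true :: false :: word x := rfl
@[simp] theorem word_pair (x : α) (y : β) : word (x, y) = true :: (word x ++ word y) := rfl
@[simp] theorem word_cons (x : α) (l : List α) : word (x :: l) = true :: (word x ++ word l) := rfl

@[simp] theorem size_false : size false = 1 := rfl
@[simp] theorem size_true : size true = 3 := rfl
@[simp] theorem size_none : size (none : Option α) = 1 := rfl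
@[simp] theorem size_some (x : α) : size (some x) = size x + 2 := rfl
@[simp] theorem size_pair (x : α) (y : β) : size (x, y) = size x + size y + 1 := by
  simp [size]
@[simp] theorem size_nil : size ([] : List α) = 1 := rfl
@[simp] theorem size_cons (x : α) (l : List α) : size (x :: l) = size x + size l + 1 := by
  simp [size]
@[simp] theorem size_nat (n : ℕ) : size n = 2 * n + 1 := by
  induction n with
  | zero => rfl
  | succ n ih =>
    have : size (n + 1) = size n + 2 := rfl
    omega

theorem size_pos (x : α) : 0 < size x := by
  unfold size word
  cases TreeCode.code x <;> simp [DataTree.word]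

theorem length_le_size (l : List α) : l.length ≤ size l := by
  induction l with
  | nil => simp
  | cons x l ih => simp; omega

theorem size_le_of_mem {x : α} {l : List α} (h : x ∈ l) : size x ≤ size l := by
  induction l with
  | nil => simp at h
  | cons y l ih =>
    rcases List.mem_cons.1 h with rfl | h
    · simp; omega
    · have := ih h
      simp; omega

theorem size_list_le {l : List α} {N : ℕ} (h : ∀ x ∈ l, size x ≤ N) :
    size l ≤ l.length * (N + 1) + 1 := by
  induction l with
  | nil => simp
  | cons y l ih =>
    have h₁ := ih fun x hx => h x (List.mem_cons_of_mem _ hx)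
    have h₂ := h y List.mem_cons_self
    simp [add_mul]
    omega

end instances

theorem eval_mono (q : Polynomial ℕ) {m n : ℕ} (h : m ≤ n) : q.eval m ≤ q.eval n := by
  rw [Polynomial.eval_eq_sum_range, Polynomial.eval_eq_sum_range]
  gcongr

/-- `f` is computable in polynomial time: some program replaces the code of `x` on top of the main
stack by the code of `f x`, whatever is below it, in a number of steps that is polynomial in the
size of `x`. -/
@[fun_prop]
def PolyTime {α β : Type} [TreeCode α] [TreeCode β] (f : α → β) : Prop :=
  ∃ (p : Prog Sym) (q : Polynomial ℕ), ∀ x, size (f x) ≤ q.eval (size x) ∧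
    ∀ R, Exec p (mainSt (word x ++ R)) (mainSt (word (f x) ++ R)) (q.eval (size x))

namespace PolyTime

section basic

variable {α β γ : Type} [TreeCode α] [TreeCode β] [TreeCode γ]

/-- The output has polynomial size. -/
theorem exists_size_le {f : α → β} (hf : PolyTime f) :
    ∃ q : Polynomial ℕ, ∀ x, size (f x) ≤ q.eval (size x) :=
  let ⟨_, q, h⟩ := hf
  ⟨q, fun x => (h x).1⟩

/-- Functions that do not change the code. -/
theorem of_word_eq {f : α → β} (h : ∀ x, word (f x) = word x) : PolyTime f :=
  ⟨.skip, .X + 1, fun x => by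
    have : size (f x) = size x := by simp [size, h]
    refine ⟨by simp; omega, fun R => ?_⟩
    rw [h]
    exact (Exec.skip _).mono (by simp)⟩

@[fun_prop] protected theorem id : PolyTime fun x : α => x := of_word_eq fun _ => rfl

@[fun_prop] theorem comp {g : β → γ} {f : α → β} (hg : PolyTime g) (hf : PolyTime f) :
    PolyTime fun x => g (f x) := by
  obtain ⟨p, q, h⟩ := hf
  obtain ⟨p', q', h'⟩ := hg
  refine ⟨.seq p p', q + q'.comp q, fun x => ?_⟩
  have hq := eval_mono q' (h x).1
  refine ⟨?_, fun R => ((h x).2 R |>.seq ((h' (f x)).2 R)).mono ?_⟩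
  · have := (h' (f x)).1
    simp [Polynomial.eval_comp]; omega
  · simp [Polynomial.eval_comp]; omega

@[fun_prop] theorem const (c : β) : PolyTime fun _ : α => c := by
  refine ⟨.seq drop (pushWord (word c)), 7 * .X + .C (size c + 4), fun x => ⟨by simp; omega,
    fun R => (Exec.seq (exec_drop _ R) (exec_pushWord _ _ R)).mono ?_⟩⟩
  have : (TreeCode.code x).word.length = size x := rfl
  have : (word c).length = size c := rfl
  simp; omega

@[fun_prop] theorem pair {f : α → β} {g : α → γ} (hf : PolyTime f) (hg : PolyTime g) :
    PolyTime fun x => (f x, g x) := by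
  obtain ⟨p, q, h⟩ := hf
  obtain ⟨p', q', h'⟩ := hg
  -- from `x` to `x, x`, to `g x, x`, to `x, g x`, to `f x, g x`
  refine ⟨.seq dup (.seq p' (.seq swap (.seq p (.push (some .main) true)))),
    8 * q + 8 * q' + 19 * .X + 20, fun x => ?_⟩
  obtain ⟨h₁, h₂⟩ := h x
  obtain ⟨h₁', h₂'⟩ := h' x
  refine ⟨by simp; omega, fun R => (Exec.seq (exec_dup _ _) (.seq (h₂' _) (.seq
    (exec_swap _ _ _) (.seq (h₂ _) ?_)))).mono (n := _) (?_ : _ + (_ + (_ + (_ + 1))) ≤ _)⟩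
  · simp only [word_pair, List.cons_append, List.append_assoc]
    exact exec_push_main ..
  · have : (TreeCode.code x).word.length = size x := rfl
    have : (TreeCode.code (g x)).word.length = size (g x) := rfl
    simp; omega

theorem fst_aux : PolyTime (Prod.fst : α × β → α) := by
  refine ⟨.case (some .main) .skip fun _ => .seq swap drop, 14 * .X + 20, fun (x, y) =>
    ⟨by simp; omega, fun R => ?_⟩⟩
  have h := exec_pop (p₀ := .skip) (s := true) (p := fun _ => .seq swap drop)
    (.seq (exec_swap (TreeCode.code x) (TreeCode.code y) R) (exec_drop _ _))
  simp only [word_pair, List.cons_append, List.append_assoc]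
  have : (TreeCode.code x).word.length = size x := rfl
  have : (TreeCode.code y).word.length = size y := rfl
  exact h.mono (by simp; omega)

theorem snd_aux : PolyTime (Prod.snd : α × β → β) := by
  refine ⟨.case (some .main) .skip fun _ => drop, 14 * .X + 20, fun (x, y) =>
    ⟨by simp; omega, fun R => ?_⟩⟩
  have h := exec_pop (p₀ := .skip) (s := true) (p := fun _ => drop)
    (exec_drop (TreeCode.code x) (word y ++ R))
  simp only [word_pair, List.cons_append, List.append_assoc]
  have : (TreeCode.code x).word.length = size x := rfl
  exact h.mono (by simp; omega)

@[fun_prop] theorem fst {f : α → β × γ} (hf : PolyTime f) : PolyTime fun x => (f x).1 :=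
  fst_aux.comp hf

@[fun_prop] theorem snd {f : α → β × γ} (hf : PolyTime f) : PolyTime fun x => (f x).2 :=
  snd_aux.comp hf

@[fun_prop] theorem some {f : α → β} (hf : PolyTime f) : PolyTime fun x => Option.some (f x) :=
  (of_word_eq fun _ => rfl : PolyTime fun p : Unit × β => Option.some p.2).comp
    ((const ()).pair hf)

@[fun_prop] theorem cons {f : α → β} {g : α → List β} (hf : PolyTime f) (hg : PolyTime g) :
    PolyTime fun x => f x :: g x :=
  (of_word_eq fun _ => rfl : PolyTime fun p : β × List β => p.1 :: p.2).comp (hf.pair hg)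

theorem tail_aux : PolyTime (List.tail : List α → List α) := by
  refine ⟨.case (.some .main) .skip fun s => if s = true then drop else .push (.some .main) false,
    14 * .X + 20, fun l => ⟨?_, fun R => ?_⟩⟩
  · cases l <;> simp; omega
  · cases l with
    | nil =>
      refine Exec.mono (m := 1 + 1) ?_ (by simp)
      exact exec_pop (s := false) (exec_push_main ..)
    | cons x l =>
      have h := exec_pop (p₀ := .skip) (s := true)
        (p := fun s => if s = true then drop else .push (.some .main) false)
        (exec_drop (TreeCode.code x) (word l ++ R))
      simp only [word_cons, List.cons_append, List.append_assoc]
      have : (TreeCode.code x).word.length = size x := rfl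
      exact h.mono (by simp; omega)

theorem head?_aux : PolyTime (List.head? : List α → Option α) := by
  refine ⟨.case (.some .main) .skip fun s =>
    if s = true then .seq swap (.seq drop (pushWord [true, false]))
    else .push (.some .main) false, 14 * .X + 20, fun l => ⟨?_, fun R => ?_⟩⟩
  · cases l <;> simp; omega
  · cases l with
    | nil =>
      refine Exec.mono (m := 1 + 1) ?_ (by simp)
      exact exec_pop (s := false) (exec_push_main ..)
    | cons x l =>
      have h := exec_pop (p₀ := .skip) (s := true) (p := fun s =>
        if s = true then .seq swap (.seq drop (pushWord [true, false]))
        else .push (.some .main) false) (.seq (exec_swap (TreeCode.code x) (TreeCode.code l) R)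
          (.seq (exec_drop _ _) (exec_pushWord _ _ _)))
      simp only [word_cons, List.cons_append, List.append_assoc]
      have : (TreeCode.code x).word.length = size x := rfl
      have : (TreeCode.code l).word.length = size l := rfl
      exact h.mono (by simp; omega)

@[fun_prop] theorem tail {f : α → List β} (hf : PolyTime f) : PolyTime fun x => (f x).tail :=
  tail_aux.comp hf

@[fun_prop] theorem head? {f : α → List β} (hf : PolyTime f) : PolyTime fun x => (f x).head? :=
  head?_aux.comp hf

/-- Case distinction on an optional value. -/
@[fun_prop] theorem optionElim {o : α → Option β} {f : α → γ} {g : α → β → γ} (ho : PolyTime o)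
    (hf : PolyTime f) (hg : PolyTime fun p : α × β => g p.1 p.2) :
    PolyTime fun x => (o x).elim (f x) (g x) := by
  have hg' : PolyTime fun p : β × α => g p.2 p.1 := hg.comp (snd_aux.pair fst_aux)
  suffices h : PolyTime fun p : Option β × α => p.1.elim (f p.2) (g p.2) from
    h.comp (ho.pair .id)
  obtain ⟨p, q, h⟩ := hf
  obtain ⟨p', q', h'⟩ := hg'
  refine ⟨.case (.some .main) .skip fun _ => .case (.some .main) .skip fun s =>
    if s = true then .case (.some .main) .skip fun _ => .seq (.push (.some .main) true) p'
    else p, q + q' + 10, fun (o, x) => ⟨?_, fun R => ?_⟩⟩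
  · cases o with
    | none =>
      have h₁ := (h x).1
      have h₂ := eval_mono q (show size x ≤ size (none : Option β) + size x + 1 by omega)
      simp at h₁ h₂ ⊢; omega
    | some y =>
      have h₁ := (h' (y, x)).1
      have h₂ := eval_mono q' (show size (y, x) ≤ size (Option.some y) + size x + 1 by simp)
      simp at h₁ h₂ ⊢; omega
  · cases o with
    | none =>
      have h₁ := (h x).2 R
      have h₂ := eval_mono q (show size x ≤ size (none : Option β) + size x + 1 by omega)
      exact (exec_pop (exec_pop (s := false) h₁)).mono (by simp at h₂ ⊢; omega)
    | some y =>
      have h₁ := (h' (y, x)).2 R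
      have h₂ := eval_mono q' (show size (y, x) ≤ size (Option.some y) + size x + 1 by simp)
      have h₃ := exec_pop (p₀ := .skip) (s := true)
        (p := fun _ => .case (.some .main) .skip fun s =>
          if s = true then .case (.some .main) .skip fun _ => .seq (.push (.some .main) true) p'
          else p) (exec_pop (s := true) (exec_pop (s := false)
            (.seq (exec_push_main ..) (by simpa using h₁))))
      simp only [word_pair, word_some, List.cons_append, List.append_assoc]
      exact h₃.mono (by simp at h₂ ⊢; omega)

@[fun_prop] theorem cond {c : α → Bool} {f g : α → γ} (hc : PolyTime c) (hf : PolyTime f)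
    (hg : PolyTime g) : PolyTime fun x => bif c x then f x else g x := by
  have h₁ : PolyTime fun b : Bool => if b = true then Option.some () else none :=
    of_word_eq fun b => by cases b <;> rfl
  have h₂ : PolyTime fun x => (if c x = true then Option.some () else none).elim (g x)
      fun _ => f x := optionElim (h₁.comp hc) hg (hf.comp fst_aux)
  convert h₂ using 2 with x
  cases c x <;> rfl

end basic

/-! ### Loops -/

section fold

variable {α β γ δ : Type} [TreeCode α] [TreeCode β] [TreeCode γ] [TreeCode δ]

/-- Iterate `p` as long as the first component of the tree on top of the main stack is not `nil`.
The stack `c` tells whether there is another round; it is empty while `p` runs, as `p` requires. -/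
def foldProg (p : Prog Sym) : Prog Sym :=
  .seq (.push (.some .c) true) (.loop (.some .c) fun _ => .case (.some .main) .skip fun _ =>
    .case (.some .main) .skip fun s =>
      if s = true then .seq (pushWord [true, true]) (.seq p (.push (.some .c) true)) else .skip)

/-- The loop with state `(l, s, x)`: the rest `l` of the list, the intermediate result `s` and the
parameter `x`. The hypothesis is that `p` performs each of the rounds in at most `T` steps. -/
theorem exec_foldProg {g : α → γ → β → γ} {p : Prog Sym} {x : α} {T : ℕ} (R : List Bool)
    (l : List β) (s : γ)
    (h : ∀ (l₁ l₂ : List β) (y : β), l₁ ++ y :: l₂ = l → ∀ R,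
      Exec p (mainSt (word ((y, l₂), (l₁.foldl (g x) s, x)) ++ R))
        (mainSt (word (l₂, ((l₁ ++ [y]).foldl (g x) s, x)) ++ R)) T) :
    Exec (foldProg p) (mainSt (word (l, (s, x)) ++ R)) (mainSt (word (l.foldl (g x) s, x) ++ R))
      (l.length * (T + 7) + 6) := by
  unfold foldProg
  refine (Exec.seq (exec_push_c ..) (n := l.length * (T + 7) + 5) ?_).mono (by omega)
  induction l generalizing s with
  | nil =>
    exact (exec_loop_c (exec_pop (s := true) (exec_pop (s := false) (.skip _)))
      exec_loop_c_nil).mono (by simp)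
  | cons y l ih =>
    have h₁ := ih (g x s y) fun l₁ l₂ z hl R => by
      simpa using h (y :: l₁) l₂ z (by simp [hl]) R
    have h₂ := h [] l y rfl R
    have h₃ := exec_loop_c (s := true) (p := fun _ => .case (.some .main) .skip fun _ =>
      .case (.some .main) .skip fun s => if s = true then
        .seq (pushWord [true, true]) (.seq p (.push (.some .c) true)) else .skip)
      (exec_pop (s := true) (exec_pop (s := true) (.seq (exec_pushWord ..)
        (.seq (by simpa using h₂) (exec_push_c ..))))) h₁
    simp only [word_pair, word_cons, List.cons_append, List.append_assoc]
    simp only [word_pair, List.cons_append, List.append_assoc] at h₃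
    refine h₃.mono ?_
    simp [add_mul]; omega

/-- Loops over a list, provided that the intermediate results are polynomially bounded. -/
theorem foldl {l : α → List β} {i : α → γ} {g : α → γ → β → γ} (hl : PolyTime l) (hi : PolyTime i)
    (hg : PolyTime fun p : α × γ × β => g p.1 p.2.1 p.2.2) (r : Polynomial ℕ)
    (hr : ∀ x l', l' <+: l x → size (l'.foldl (g x) (i x)) ≤ r.eval (size x)) :
    PolyTime fun x => (l x).foldl (g x) (i x) := by
  have hbody : PolyTime fun p : (β × List β) × (γ × α) =>
      (p.1.2, (g p.2.2 p.2.1 p.1.1, p.2.2)) := by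
    have : PolyTime fun p : (β × List β) × (γ × α) => g p.2.2 p.2.1 p.1.1 :=
      hg.comp (g := fun p : α × γ × β => g p.1 p.2.1 p.2.2)
        (f := fun p : (β × List β) × (γ × α) => (p.2.2, p.2.1, p.1.1)) (by fun_prop)
    fun_prop
  obtain ⟨ql, hql⟩ := hl.exists_size_le
  obtain ⟨p, q, h⟩ := hbody
  -- the loop gets the argument `x` as part of its state and is only run on codes of such states
  suffices hs : ∃ (p : Prog Sym) (q : Polynomial ℕ), ∀ x, size ((l x).foldl (g x) (i x), x) ≤
      q.eval (size x) ∧ ∀ R, Exec p (mainSt (word (l x, i x, x) ++ R))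
        (mainSt (word ((l x).foldl (g x) (i x), x) ++ R)) (q.eval (size x)) by
    obtain ⟨p₁, q₁, h₁⟩ := hs
    obtain ⟨p₀, q₀, h₀⟩ : PolyTime fun x => (l x, i x, x) := by fun_prop
    suffices hs' : PolyTime fun x => ((l x).foldl (g x) (i x), x) from hs'.fst
    refine ⟨.seq p₀ p₁, q₀ + q₁, fun x => ⟨?_, fun R => ?_⟩⟩
    · have := (h₁ x).1
      simp at this ⊢; omega
    · exact (((h₀ x).2 R).seq ((h₁ x).2 R)).mono (by simp)
  refine ⟨foldProg p, ql * (q.comp (2 * ql + r + .X + 4) + 7) + 6 + r + .X + 1, fun x =>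
    ⟨?_, fun R => ?_⟩⟩
  · have := hr x (l x) (List.prefix_refl _)
    simp; omega
  · have hT : ∀ (l₁ l₂ : List β) (y : β), l₁ ++ y :: l₂ = l x → ∀ R,
        Exec p (mainSt (word ((y, l₂), (l₁.foldl (g x) (i x), x)) ++ R))
          (mainSt (word (l₂, ((l₁ ++ [y]).foldl (g x) (i x), x)) ++ R))
          (q.eval ((2 * ql + r + .X + 4 : Polynomial ℕ).eval (size x))) := by
      intro l₁ l₂ y hl R
      have h₁ := (h ((y, l₂), (l₁.foldl (g x) (i x), x))).2 R
      simp only [List.foldl_append, List.foldl_cons, List.foldl_nil]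
      refine h₁.mono (eval_mono q ?_)
      have h₂ := hr x l₁ ⟨y :: l₂, hl⟩
      have h₃ := hql x
      have h₄ : size (y :: l₂) ≤ size (l x) := by
        rw [← hl]
        clear hl h₁ h₂
        induction l₁ with
        | nil => simp
        | cons z l₁ ih => simp at ih ⊢; omega
      simp at h₂ h₃ h₄ ⊢
      omega
    refine (exec_foldProg R (l x) (i x) hT).mono ?_
    have h₁ := (length_le_size (l x)).trans (hql x)
    have h₂ := Nat.mul_le_mul_right
      (q.eval ((2 * ql + r + .X + 4 : Polynomial ℕ).eval (size x)) + 7) h₁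
    simp only [Polynomial.eval_add, Polynomial.eval_mul, Polynomial.eval_comp, Polynomial.eval_X,
      Polynomial.eval_ofNat, Polynomial.eval_one] at h₂ ⊢
    omega

/-- Loops in which each round adds a polynomially bounded amount to the intermediate result. -/
theorem foldl_of_additive {l : α → List β} {i : α → γ} {g : α → γ → β → γ} (hl : PolyTime l)
    (hi : PolyTime i) (hg : PolyTime fun p : α × γ × β => g p.1 p.2.1 p.2.2) (r : Polynomial ℕ)
    (hr : ∀ x s, ∀ y ∈ l x, size (g x s y) ≤ size s + r.eval (size x)) :
    PolyTime fun x => (l x).foldl (g x) (i x) := by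
  obtain ⟨ql, hql⟩ := hl.exists_size_le
  obtain ⟨qi, hqi⟩ := hi.exists_size_le
  refine foldl hl hi hg (qi + ql * r) fun x l' hl' => ?_
  have h (l' : List β) (h' : ∀ y ∈ l', y ∈ l x) (s : γ) :
      size (l'.foldl (g x) s) ≤ size s + l'.length * r.eval (size x) := by
    induction l' generalizing s with
    | nil => simp
    | cons y l' ih =>
      have h₁ := ih (fun z hz => h' z (List.mem_cons_of_mem _ hz)) (g x s y)
      have h₂ := hr x s y (h' y List.mem_cons_self)
      simp [add_mul]; omega
  have h₁ := h l' (fun y hy => hl'.subset hy) (i x)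
  have h₂ := Nat.mul_le_mul_right (r.eval (size x))
    (hl'.length_le.trans ((length_le_size (l x)).trans (hql x)))
  have := hqi x
  simp; omega

end fold

end PolyTime

/-! ### From polynomial-time functions to Turing machines -/

/-- The input can be moved to the main stack, where it is coded as a list of symbols; its order is
reversed. -/
theorem exists_exec_readInput : ∃ (p : Prog Sym) (q : Polynomial ℕ), ∀ w : List Γ',
    size w.reverse ≤ q.eval w.length ∧
      Exec p (st w [] [] [] []) (mainSt (word w.reverse)) (q.eval w.length) := by
  have hsym (a : Γ') : (word a).length ≤ 9 := by
    rcases a with _ | (_ | _) | _ | _ | _ <;> decide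
  refine ⟨.seq (.push (some .main) false) (.loop none fun a : Γ' =>
    .seq (pushWord (word a)) (.push (some .main) true)), 20 * .X + 5, fun w => ⟨?_, ?_⟩⟩
  · have := size_list_le (l := w.reverse) (N := 9) fun a _ => hsym a
    simp at this ⊢; omega
  · have h (w l : List Γ') : Exec (.loop none fun a : Γ' =>
        .seq (pushWord (word a)) (.push (some .main) true)) (st w (word l) [] [] [])
          (mainSt (word (w.reverse ++ l))) (20 * w.length + 1) := by
      induction w generalizing l with
      | nil => exact .loop_nil rfl
      | cons a w ih =>
        have h := Exec.loop_cons (k := none) (S := st (a :: w) (word l) [] [] []) (a := a) (l := w)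
          (p := fun a : Γ' => .seq (pushWord (word a)) (.push (some .main) true))
          (m := (word a).length + 1 + 1) rfl
          (by rw [update_st_none]; exact .seq (exec_pushWord ..) (exec_push_main ..)) (ih (a :: l))
        simp only [List.reverse_cons, List.append_assoc, List.cons_append, List.nil_append]
        have := hsym a
        exact h.mono (by simp; omega)
    have h' := Exec.seq (exec_push_main w [] [] [] [] false) (h w [])
    simp only [List.append_nil] at h'
    exact h'.mono (by simp; omega)

/-- The code of a truth value can be replaced by the truth value itself. -/
theorem exists_exec_writeOutput : ∃ p : Prog Sym, ∀ b : Bool,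
    Exec p (mainSt (word b)) (mainSt [b]) 4 := by
  refine ⟨.case (some .main) .skip fun s => if s = true then .case (some .main) .skip fun _ =>
    .case (some .main) .skip fun _ => .push (some .main) true else .push (some .main) false,
    fun b => ?_⟩
  cases b
  · refine Exec.mono (m := 1 + 1) ?_ (by omega)
    exact exec_pop (s := false) (exec_push_main ..)
  · exact exec_pop (s := true) (exec_pop (s := false) (exec_pop (s := false) (exec_push_main ..)))

/-- A predicate on words that is computable in polynomial time in the present sense is computed
by a Turing machine in polynomial time. -/
theorem PolyTime.tm2ComputableInPolyTime {α : Type} {enc : α → List Γ'} {f : α → Bool}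
    {g : List Γ' → Bool} (hg : PolyTime g) (h : ∀ x, f x = g (enc x).reverse) :
    Nonempty (TM2ComputableInPolyTime enc encodeBool f) := by
  obtain ⟨p₁, q₁, h₁⟩ := exists_exec_readInput
  obtain ⟨p₂, q₂, h₂⟩ := hg
  obtain ⟨p₃, h₃⟩ := exists_exec_writeOutput
  refine Prog.polyTime_of_exec (.seq p₁ (.seq p₂ p₃)) none (Option.some Aux.main) enc encodeBool f
    (.refl _) (.refl _) (q₁ + q₂.comp q₁ + 4) fun x => ?_
  have e₁ : (Function.update (fun _ => []) none (enc x) : ∀ k, List (Sym k)) =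
      st (enc x) [] [] [] [] := by
    funext k; rcases k with _ | _ | _ <;> rfl
  have e₂ (b : Bool) : (Function.update (fun _ => []) (Option.some Aux.main) [b] :
      ∀ k, List (Sym k)) = mainSt [b] := by
    funext k; rcases k with _ | _ | _ <;> rfl
  have h₂' := (h₂ (enc x).reverse).2 []
  simp only [List.append_nil] at h₂'
  have key := ((h₁ (enc x)).2).seq (h₂'.seq (h₃ _))
  rw [← h] at key
  have hq := eval_mono q₂ (h₁ (enc x)).1
  simp only [Equiv.refl_symm, Equiv.coe_refl, List.map_id, encodeBool, pure, e₁, e₂]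
  exact key.mono (by simp [Polynomial.eval_comp]; omega)

end StackProgram

namespace StackProgram

/-! ### Polynomial-time functions on lists and numbers -/

namespace PolyTime

variable {α β γ : Type} [TreeCode α] [TreeCode β] [TreeCode γ]

/-- Loops in which no round makes the intermediate result larger than a polynomial bound. -/
theorem foldl_of_max {l : α → List β} {i : α → γ} {g : α → γ → β → γ} (hl : PolyTime l)
    (hi : PolyTime i) (hg : PolyTime fun p : α × γ × β => g p.1 p.2.1 p.2.2) (r : Polynomial ℕ)
    (hr : ∀ x s y, size (g x s y) ≤ max (size s) (r.eval (size x))) :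
    PolyTime fun x => (l x).foldl (g x) (i x) := by
  obtain ⟨qi, hqi⟩ := hi.exists_size_le
  refine foldl hl hi hg (qi + r) fun x l' hl' => ?_
  clear hl'
  have h (s : γ) : size (l'.foldl (g x) s) ≤ max (size s) (r.eval (size x)) := by
    induction l' generalizing s with
    | nil => simp
    | cons y l' ih =>
      have h₁ := ih (g x s y)
      have h₂ := hr x s y
      simp only [List.foldl_cons]; omega
  have h₁ := h (i x)
  have h₂ := hqi x
  simp; omega

@[fun_prop] theorem not {f : α → Bool} (hf : PolyTime f) : PolyTime fun x => !f x := by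
  convert hf.cond (const false) (const true) using 2 with x
  cases f x <;> rfl

@[fun_prop] theorem and {f g : α → Bool} (hf : PolyTime f) (hg : PolyTime g) :
    PolyTime fun x => f x && g x := by
  convert hf.cond hg (const false) using 2 with x
  cases f x <;> rfl

@[fun_prop] theorem or {f g : α → Bool} (hf : PolyTime f) (hg : PolyTime g) :
    PolyTime fun x => f x || g x := by
  convert hf.cond (const true) hg using 2 with x
  cases f x <;> rfl

@[fun_prop] theorem beq_bool {f g : α → Bool} (hf : PolyTime f) (hg : PolyTime g) :
    PolyTime fun x => f x == g x := by
  convert hf.cond hg hg.not using 2 with x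
  cases f x <;> cases g x <;> rfl

@[fun_prop] theorem isSome {f : α → Option β} (hf : PolyTime f) :
    PolyTime fun x => (f x).isSome := by
  convert hf.optionElim (g := fun _ _ => true) (const false) (const true) using 2 with x
  cases f x <;> rfl

@[fun_prop] theorem getD {f : α → Option β} {g : α → β} (hf : PolyTime f) (hg : PolyTime g) :
    PolyTime fun x => (f x).getD (g x) := by
  convert hf.optionElim (g := fun _ y => y) hg snd_aux using 2 with x
  cases f x <;> rfl

@[fun_prop] theorem reverse {f : α → List β} (hf : PolyTime f) :
    PolyTime fun x => (f x).reverse := by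
  have h := foldl_of_additive (i := fun _ => []) (g := fun (_ : α) (s : List β) y => y :: s) hf
    (const _) (by fun_prop) (hf.exists_size_le.choose + 1) fun x s y hy => by
      have h₁ := hf.exists_size_le.choose_spec x
      have h₂ := size_le_of_mem hy
      simp; omega
  convert h using 2 with x
  simp

/-- Loops from the end of a list, provided that the intermediate results are polynomially
bounded. -/
theorem foldr {l : α → List β} {i : α → γ} {g : α → β → γ → γ} (hl : PolyTime l) (hi : PolyTime i)
    (hg : PolyTime fun p : α × β × γ => g p.1 p.2.1 p.2.2) (r : Polynomial ℕ)
    (hr : ∀ x l', l' <:+ l x → size (l'.foldr (g x) (i x)) ≤ r.eval (size x)) :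
    PolyTime fun x => (l x).foldr (g x) (i x) := by
  have hg' : PolyTime fun p : α × γ × β => g p.1 p.2.2 p.2.1 :=
    hg.comp (f := fun p : α × γ × β => (p.1, p.2.2, p.2.1)) (by fun_prop)
  have h := foldl (g := fun x s y => g x y s) hl.reverse hi hg' r fun x l' hl' => by
    rw [← List.foldr_reverse]
    exact hr x l'.reverse (by rw [← List.reverse_prefix, List.reverse_reverse]; exact hl')
  convert h using 2 with x
  simp

/-- Loops from the end of a list in which each round adds a polynomially bounded amount. -/
theorem foldr_of_additive {l : α → List β} {i : α → γ} {g : α → β → γ → γ} (hl : PolyTime l)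
    (hi : PolyTime i) (hg : PolyTime fun p : α × β × γ => g p.1 p.2.1 p.2.2) (r : Polynomial ℕ)
    (hr : ∀ x s, ∀ y ∈ l x, size (g x y s) ≤ size s + r.eval (size x)) :
    PolyTime fun x => (l x).foldr (g x) (i x) := by
  have hg' : PolyTime fun p : α × γ × β => g p.1 p.2.2 p.2.1 :=
    hg.comp (f := fun p : α × γ × β => (p.1, p.2.2, p.2.1)) (by fun_prop)
  have h := foldl_of_additive (g := fun x s y => g x y s) hl.reverse hi hg' r fun x s y hy =>
    hr x s y (by simpa using hy)
  convert h using 2 with x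
  simp

/-- The values of a polynomial-time function at the entries of a list are polynomially bounded. -/
theorem exists_size_le_of_mem {l : α → List β} {g : α → β → γ} (hl : PolyTime l)
    (hg : PolyTime fun p : α × β => g p.1 p.2) :
    ∃ q : Polynomial ℕ, ∀ x, ∀ y ∈ l x, size (g x y) ≤ q.eval (size x) := by
  obtain ⟨ql, hql⟩ := hl.exists_size_le
  obtain ⟨q, hq⟩ := hg.exists_size_le
  refine ⟨q.comp (.X + ql + 1), fun x y hy => (hq (x, y)).trans ?_⟩
  rw [Polynomial.eval_comp]
  refine eval_mono q ?_
  have h₁ := hql x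
  have h₂ := size_le_of_mem hy
  simp; omega

@[fun_prop] theorem map {l : α → List β} {g : α → β → γ} (hl : PolyTime l)
    (hg : PolyTime fun p : α × β => g p.1 p.2) : PolyTime fun x => (l x).map (g x) := by
  obtain ⟨q, hq⟩ := exists_size_le_of_mem hl hg
  have hg' : PolyTime fun p : α × β × List γ => g p.1 p.2.1 :=
    hg.comp (f := fun p : α × β × List γ => (p.1, p.2.1)) (by fun_prop)
  have h := foldr_of_additive (i := fun _ => []) (g := fun x y s => g x y :: s) hl (const _)
    (by fun_prop) (q + 1) fun x s y hy => by
      have := hq x y hy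
      simp; omega
  convert h using 2 with x
  induction l x <;> simp_all

@[fun_prop] theorem append {f g : α → List β} (hf : PolyTime f) (hg : PolyTime g) :
    PolyTime fun x => f x ++ g x := by
  obtain ⟨q, hq⟩ := hf.exists_size_le
  have h := foldr_of_additive (g := fun _ y s => y :: s) hf hg (by fun_prop) (q + 1)
    fun x s y hy => by
      have h₁ := hq x
      have h₂ := size_le_of_mem hy
      simp; omega
  convert h using 2 with x
  simp

theorem size_append (l l' : List β) : size (l ++ l') + 1 = size l + size l' := by
  induction l with
  | nil => simp; omega
  | cons x l ih => simp; omega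

@[fun_prop] theorem flatMap {l : α → List β} {g : α → β → List γ} (hl : PolyTime l)
    (hg : PolyTime fun p : α × β => g p.1 p.2) : PolyTime fun x => (l x).flatMap (g x) := by
  obtain ⟨q, hq⟩ := exists_size_le_of_mem hl hg
  have hg' : PolyTime fun p : α × β × List γ => g p.1 p.2.1 :=
    hg.comp (f := fun p : α × β × List γ => (p.1, p.2.1)) (by fun_prop)
  have h := foldr_of_additive (i := fun _ => []) (g := fun x y s => g x y ++ s) hl (const _)
    (by fun_prop) q fun x s y hy => by
      have h₁ := hq x y hy
      have h₂ := size_append (g x y) s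
      omega
  convert h using 2 with x
  induction l x <;> simp_all

@[fun_prop] theorem filter {l : α → List β} {c : α → β → Bool} (hl : PolyTime l)
    (hc : PolyTime fun p : α × β => c p.1 p.2) : PolyTime fun x => (l x).filter (c x) := by
  have h := hl.flatMap (g := fun x y => bif c x y then [y] else []) (by fun_prop)
  convert h using 2 with x
  induction l x with
  | nil => rfl
  | cons y l ih => cases hy : c x y <;> simp [hy, ih]

@[fun_prop] theorem isEmpty {l : α → List β} (hl : PolyTime l) :
    PolyTime fun x => (l x).isEmpty := by
  convert hl.head?.isSome.not using 2 with x
  cases l x <;> rfl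

@[fun_prop] theorem any {l : α → List β} {c : α → β → Bool} (hl : PolyTime l)
    (hc : PolyTime fun p : α × β => c p.1 p.2) : PolyTime fun x => (l x).any (c x) := by
  convert (hl.filter hc).isEmpty.not using 2 with x
  induction l x with
  | nil => rfl
  | cons y l ih => cases hy : c x y <;> simp [hy, ih]

@[fun_prop] theorem all {l : α → List β} {c : α → β → Bool} (hl : PolyTime l)
    (hc : PolyTime fun p : α × β => c p.1 p.2) : PolyTime fun x => (l x).all (c x) := by
  convert (hl.any (c := fun x y => !c x y) (by fun_prop)).not using 2 with x
  simp [List.all_eq_not_any_not]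

@[fun_prop] theorem find? {l : α → List β} {c : α → β → Bool} (hl : PolyTime l)
    (hc : PolyTime fun p : α × β => c p.1 p.2) : PolyTime fun x => (l x).find? (c x) := by
  convert (hl.filter hc).head? using 2 with x
  simp

/-- Numbers are coded in unary, hence like lists of units. -/
theorem word_replicate (n : ℕ) : word (List.replicate n ()) = word n := rfl

theorem word_length (l : List Unit) : word l.length = word l := by
  rw [← word_replicate]
  congr 1
  exact (List.eq_replicate_length.2 fun _ _ => rfl).symm

@[fun_prop] theorem replicate_unit {f : α → ℕ} (hf : PolyTime f) :
    PolyTime fun x => List.replicate (f x) () :=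
  (of_word_eq word_replicate : PolyTime fun n : ℕ => List.replicate n ()).comp hf

@[fun_prop] theorem length {l : α → List β} (hl : PolyTime l) : PolyTime fun x => (l x).length := by
  have h := (of_word_eq word_length : PolyTime fun l : List Unit => l.length).comp
    (hl.map (g := fun _ _ => ()) (const ()))
  simpa using h

@[fun_prop] theorem add {f g : α → ℕ} (hf : PolyTime f) (hg : PolyTime g) :
    PolyTime fun x => f x + g x := by
  simpa using (hf.replicate_unit.append hg.replicate_unit).length

@[fun_prop] theorem drop {l : α → List β} {f : α → ℕ} (hl : PolyTime l) (hf : PolyTime f) :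
    PolyTime fun x => (l x).drop (f x) := by
  have h := foldl_of_additive (g := fun _ s _ => s.tail) hf.replicate_unit hl (by fun_prop) 0
    fun x s y _ => by cases s <;> simp; omega
  have h' (n : ℕ) (l : List β) : (List.replicate n ()).foldl (fun s _ => s.tail) l = l.drop n := by
    induction n generalizing l with
    | zero => rfl
    | succ n ih => rw [List.replicate_succ, List.foldl_cons, ih, List.drop_tail]
  simpa only [h'] using h

@[fun_prop] theorem sub {f g : α → ℕ} (hf : PolyTime f) (hg : PolyTime g) :
    PolyTime fun x => f x - g x := by
  simpa using (hf.replicate_unit.drop hg).length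

@[fun_prop] theorem decide_le {f g : α → ℕ} (hf : PolyTime f) (hg : PolyTime g) :
    PolyTime fun x => decide (f x ≤ g x) := by
  convert (hf.replicate_unit.drop hg).isEmpty using 2 with x
  rw [Bool.eq_iff_iff]
  simp [Nat.sub_eq_zero_iff_le]

@[fun_prop] theorem decide_lt {f g : α → ℕ} (hf : PolyTime f) (hg : PolyTime g) :
    PolyTime fun x => decide (f x < g x) :=
  decide_le (hf.add (const 1)) hg

@[fun_prop] theorem decide_eq {f g : α → ℕ} (hf : PolyTime f) (hg : PolyTime g) :
    PolyTime fun x => decide (f x = g x) := by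
  convert (hf.decide_le hg).and (hg.decide_le hf) using 2 with x
  rw [Bool.eq_iff_iff]
  simp [le_antisymm_iff]

@[fun_prop] theorem list_getD {l : α → List β} {f : α → ℕ} {d : α → β} (hl : PolyTime l)
    (hf : PolyTime f) (hd : PolyTime d) : PolyTime fun x => (l x).getD (f x) (d x) := by
  convert ((hl.drop hf).head?).getD hd using 2 with x
  simp [List.getD_eq_getElem?_getD, List.head?_drop]

@[fun_prop] theorem sum {l : α → List ℕ} (hl : PolyTime l) : PolyTime fun x => (l x).sum := by
  have h := (hl.flatMap (g := fun _ n => List.replicate n ()) (by fun_prop)).length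
  convert h using 2 with x
  simp

@[fun_prop] theorem range {f : α → ℕ} (hf : PolyTime f) : PolyTime fun x => List.range (f x) := by
  obtain ⟨q, hq⟩ := hf.exists_size_le
  have h (n : ℕ) : (List.replicate n ()).foldl (fun s _ => s ++ [s.length]) [] = List.range n := by
    induction n with
    | zero => rfl
    | succ n ih => simp [List.replicate_succ', ih, List.range_succ]
  have h' := foldl (i := fun _ => []) (g := fun (_ : α) (s : List ℕ) _ => s ++ [s.length])
    hf.replicate_unit (const _) (by fun_prop) (q * (2 * q + 4) + 1) fun x l' hl' => by
      obtain ⟨n, rfl⟩ : ∃ n, l' = List.replicate n () :=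
        ⟨l'.length, List.eq_replicate_length.2 fun _ _ => rfl⟩
      have h₁ : n ≤ f x := by simpa using hl'.length_le
      have h₂ := hq x
      rw [h]
      refine (size_list_le (N := 2 * n + 1) fun k hk => ?_).trans ?_
      · have := List.mem_range.1 hk
        simp; omega
      · rw [size_nat] at h₂
        simp only [List.length_range, Polynomial.eval_add, Polynomial.eval_mul,
          Polynomial.eval_ofNat, Polynomial.eval_one]
        gcongr <;> omega
  convert h' using 2 with x
  exact (h _).symm

end PolyTime

end StackProgram

namespace JudgmentAggregation

open Computability StackProgram

/-! ### Binary arithmetic -/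

/-- The number with the given binary digits, the least significant digit first. -/
def bitsVal (l : List Bool) : ℕ := l.foldr (fun b n => b.toNat + 2 * n) 0

@[simp] theorem bitsVal_nil : bitsVal [] = 0 := rfl
@[simp] theorem bitsVal_cons (b : Bool) (l : List Bool) :
    bitsVal (b :: l) = b.toNat + 2 * bitsVal l := rfl

theorem bitsVal_encodeNat (m : ℕ) : bitsVal (encodeNat m) = m := by
  have h (p : PosNum) : bitsVal (encodePosNum p) = (p : ℕ) := by
    induction p with
    | one => rfl
    | bit0 p ih => simp [encodePosNum, ih, PosNum.cast_bit0]; omega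
    | bit1 p ih => simp [encodePosNum, ih, PosNum.cast_bit1]; omega
  have h' (k : Num) : bitsVal (encodeNum k) = (k : ℕ) := by
    cases k with
    | zero => rfl
    | pos p => exact h p
  rw [encodeNat, h', Num.to_of_nat]

theorem bitsVal_append (l : List Bool) (b : Bool) :
    bitsVal (l ++ [b]) = bitsVal l + 2 ^ l.length * b.toNat := by
  induction l with
  | nil => simp
  | cons c l ih => simp [ih, pow_succ]; ring

theorem bitsVal_take_succ (l : List Bool) (n : ℕ) :
    bitsVal (l.take (n + 1)) = bitsVal (l.take n) + 2 ^ n * (l.getD n false).toNat := by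
  induction l generalizing n with
  | nil => simp
  | cons b l ih =>
    cases n with
    | zero => simp
    | succ n => simp [ih n, pow_succ]; ring

theorem bitsVal_lt (l : List Bool) : bitsVal l < 2 ^ l.length := by
  induction l with
  | nil => simp
  | cons b l ih => cases b <;> simp [pow_succ] <;> omega

theorem bitsVal_take_lt (l : List Bool) (n : ℕ) : bitsVal (l.take n) < 2 ^ n :=
  (bitsVal_lt _).trans_le (Nat.pow_le_pow_right (by omega) (by simp))

/-- One digit of the schoolbook addition of `a` and `b`; the state consists of the carry and of the
digits of the sum so far, the most significant digit first. -/
def addStep (a b : List Bool) (s : Bool × List Bool) (i : ℕ) : Bool × List Bool :=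
  ((a.getD i false && b.getD i false) || (s.1 && (a.getD i false || b.getD i false)),
    (a.getD i false == (b.getD i false == s.1)) :: s.2)

/-- The sum of two binary numbers. -/
def addBits (a b : List Bool) : List Bool :=
  ((List.range (a.length + b.length + 1)).foldl (addStep a b) (false, [])).2.reverse

theorem length_addBits (a b : List Bool) : (addBits a b).length = a.length + b.length + 1 := by
  have h (n : ℕ) : ((List.range n).foldl (addStep a b) (false, [])).2.length = n := by
    induction n with
    | zero => rfl
    | succ n ih => simp [List.range_succ, addStep, ih]
  simp [addBits, h]

theorem bitsVal_addBits (a b : List Bool) : bitsVal (addBits a b) = bitsVal a + bitsVal b := by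
  have h (n : ℕ) : ((List.range n).foldl (addStep a b) (false, [])).2.length = n ∧
      bitsVal ((List.range n).foldl (addStep a b) (false, [])).2.reverse +
        2 ^ n * ((List.range n).foldl (addStep a b) (false, [])).1.toNat =
      bitsVal (a.take n) + bitsVal (b.take n) := by
    induction n with
    | zero => simp
    | succ n ih =>
      obtain ⟨ih₁, ih₂⟩ := ih
      rw [List.range_succ, List.foldl_append, List.foldl_cons, List.foldl_nil,
        bitsVal_take_succ, bitsVal_take_succ]
      revert ih₁ ih₂
      generalize (List.range n).foldl (addStep a b) (false, []) = s
      obtain ⟨c, out⟩ := s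
      intro ih₁ ih₂
      refine ⟨by simp [addStep, ih₁], ?_⟩
      simp only [addStep, List.reverse_cons, bitsVal_append, List.length_reverse]
      simp only at ih₁ ih₂
      rw [ih₁, pow_succ]
      cases a.getD n false <;> cases b.getD n false <;> cases c <;> simp at ih₂ ⊢ <;> omega
  obtain ⟨-, h⟩ := h (a.length + b.length + 1)
  rw [List.take_of_length_le (by omega), List.take_of_length_le (by omega)] at h
  have h₁ : bitsVal a < 2 ^ (a.length + b.length) :=
    (bitsVal_lt a).trans_le (Nat.pow_le_pow_right (by omega) (by omega))
  have h₂ : bitsVal b < 2 ^ (a.length + b.length) :=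
    (bitsVal_lt b).trans_le (Nat.pow_le_pow_right (by omega) (by omega))
  -- the number of rounds is so large that no carry is left
  rw [pow_succ] at h
  unfold addBits
  cases hc : ((List.range (a.length + b.length + 1)).foldl (addStep a b) (false, [])).1 <;>
    simp [hc] at h <;> omega

/-- Comparison of two binary numbers, from the least to the most significant digit. -/
def leBits (a b : List Bool) : Bool :=
  (List.range (a.length + b.length)).foldl
    (fun s i => bif a.getD i false == b.getD i false then s else b.getD i false) true

theorem leBits_iff (a b : List Bool) : leBits a b = true ↔ bitsVal a ≤ bitsVal b := by
  have h (n : ℕ) : (List.range n).foldl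
      (fun s i => bif a.getD i false == b.getD i false then s else b.getD i false) true = true ↔
      bitsVal (a.take n) ≤ bitsVal (b.take n) := by
    induction n with
    | zero => simp
    | succ n ih =>
      rw [List.range_succ, List.foldl_append, List.foldl_cons, List.foldl_nil,
        bitsVal_take_succ, bitsVal_take_succ]
      have h₁ := bitsVal_take_lt a n
      have h₂ := bitsVal_take_lt b n
      revert ih
      generalize List.foldl _ true (List.range n) = s
      intro ih
      cases a.getD n false <;> cases b.getD n false <;> simp [ih] <;> omega
  rw [leBits, h, List.take_of_length_le (by omega), List.take_of_length_le (by omega)]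

theorem polyTime_addBits_aux : PolyTime fun x : List Bool × List Bool => addBits x.1 x.2 := by
  have h := PolyTime.foldl_of_additive
    (l := fun x : List Bool × List Bool => List.range (x.1.length + x.2.length + 1))
    (i := fun _ => (false, [])) (g := fun x s i => addStep x.1 x.2 s i) (by fun_prop) (by fun_prop)
    (by unfold addStep; fun_prop) 6 fun x s i _ => by
      have hb (b : Bool) : 1 ≤ size b ∧ size b ≤ 3 := by cases b <;> simp
      obtain ⟨c, l⟩ := s
      have h₁ := hb c
      have h₂ := hb (addStep x.1 x.2 (c, l) i).1
      have h₃ := hb (x.1.getD i false == (x.2.getD i false == c))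
      have h₄ : addStep x.1 x.2 (c, l) i = ((addStep x.1 x.2 (c, l) i).1,
        (x.1.getD i false == (x.2.getD i false == c)) :: l) := rfl
      rw [h₄, size_pair, size_pair, size_cons, Polynomial.eval_ofNat]
      omega
  exact h.snd.reverse

theorem polyTime_leBits_aux : PolyTime fun x : List Bool × List Bool => leBits x.1 x.2 :=
  PolyTime.foldl_of_additive
    (l := fun x : List Bool × List Bool => List.range (x.1.length + x.2.length))
    (i := fun _ => true) (g := fun x s i =>
      bif x.1.getD i false == x.2.getD i false then s else x.2.getD i false) (by fun_prop)
    (by fun_prop) (by fun_prop) 2 fun x s i _ => by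
      have hb (b : Bool) : 1 ≤ size b ∧ size b ≤ 3 := by cases b <;> simp
      have h₁ := hb s
      have h₂ := hb (bif x.1.getD i false == x.2.getD i false then s else x.2.getD i false)
      rw [Polynomial.eval_ofNat]
      omega

section

variable {α : Type} [TreeCode α]

@[fun_prop] theorem polyTime_addBits {f g : α → List Bool} (hf : PolyTime f) (hg : PolyTime g) :
    PolyTime fun x => addBits (f x) (g x) :=
  polyTime_addBits_aux.comp (hf.pair hg)

@[fun_prop] theorem polyTime_leBits {f g : α → List Bool} (hf : PolyTime f) (hg : PolyTime g) :
    PolyTime fun x => leBits (f x) (g x) :=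
  polyTime_leBits_aux.comp (hf.pair hg)

end

/-! ### The knapsack table -/

/-- What the dynamic program knows about an issue: its cost in binary, the weights of the values
`false` and `true`, and whether these values are allowed. -/
abbrev Item := List Bool × (ℕ × ℕ) × (Bool × Bool)

/-- The minimum of two costs, where `none` means that there is no solution. -/
def minCost (x y : Option (List Bool)) : Option (List Bool) :=
  x.elim y fun a => some (y.elim a fun b => bif leBits a b then a else b)

/-- The table for one more issue. Entry `v` of the table `d` for the other issues is the least cost
of a choice of total weight `v`. -/
def knapsackStep (V : ℕ) (it : Item) (d : List (Option (List Bool))) :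
    List (Option (List Bool)) :=
  (List.range V).map fun v => minCost
    (bif it.2.2.1 && decide (it.2.1.1 ≤ v) then d.getD (v - it.2.1.1) none else none)
    (bif it.2.2.2 && decide (it.2.1.2 ≤ v) then
      (d.getD (v - it.2.1.2) none).elim none fun c => some (addBits c it.1) else none)

/-- The table of the least costs of the choices of total weight `0, …, V - 1`. -/
def knapsackTable (V : ℕ) (items : List Item) : List (Option (List Bool)) :=
  items.foldr (knapsackStep V)
    ((List.range V).map fun v => bif decide (v = 0) then some [] else none)

/-- Is there a choice of total weight `v` whose cost is at most `B`? -/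
def knapsack (items : List Item) (B : List Bool) (v : ℕ) : Bool :=
  ((knapsackTable (v + 1) items).getD v none).elim false fun c => leBits c B

/-- There is a choice of total weight `v` and of cost at most `C`. -/
def Reachable : List Item → ℕ → ℕ → Prop
  | [], v, _ => v = 0
  | it :: items, v, C =>
    (it.2.2.1 = true ∧ it.2.1.1 ≤ v ∧ Reachable items (v - it.2.1.1) C) ∨
      (it.2.2.2 = true ∧ it.2.1.2 ≤ v ∧ bitsVal it.1 ≤ C ∧
        Reachable items (v - it.2.1.2) (C - bitsVal it.1))

theorem exists_mem_minCost (x y : Option (List Bool)) (C : ℕ) :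
    (∃ c ∈ minCost x y, bitsVal c ≤ C) ↔ (∃ c ∈ x, bitsVal c ≤ C) ∨ ∃ c ∈ y, bitsVal c ≤ C := by
  cases x with
  | none => simp [minCost]
  | some a =>
    cases y with
    | none => simp [minCost]
    | some b =>
      cases h : leBits a b with
      | true =>
        have := (leBits_iff a b).1 h
        simp [minCost, h]; omega
      | false =>
        have : ¬ bitsVal a ≤ bitsVal b := fun h' => by simp [(leBits_iff a b).2 h'] at h
        simp [minCost, h]; omega

/-- The entries of the table are characterized by the budgets for which they suffice, so that minima
need not be mentioned. -/
theorem exists_mem_knapsackTable (V : ℕ) (items : List Item) (v C : ℕ) (hv : v < V) :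
    (∃ c ∈ (knapsackTable V items).getD v none, bitsVal c ≤ C) ↔ Reachable items v C := by
  induction items generalizing v C with
  | nil =>
    rw [knapsackTable, List.foldr_nil, List.getD_eq_getElem?_getD, List.getElem?_map,
      List.getElem?_range hv]
    by_cases h : v = 0 <;> simp [Reachable, h]
  | cons it items ih =>
    have h : (knapsackTable V (it :: items)).getD v none =
        minCost (bif it.2.2.1 && decide (it.2.1.1 ≤ v) then
          (knapsackTable V items).getD (v - it.2.1.1) none else none)
        (bif it.2.2.2 && decide (it.2.1.2 ≤ v) then
          ((knapsackTable V items).getD (v - it.2.1.2) none).elim none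
            fun c => some (addBits c it.1) else none) := by
      rw [show knapsackTable V (it :: items) = knapsackStep V it (knapsackTable V items) from rfl,
        knapsackStep, List.getD_eq_getElem?_getD, List.getElem?_map, List.getElem?_range hv]
      rfl
    have ih₁ := ih (v - it.2.1.1) C (by omega)
    have ih₂ := ih (v - it.2.1.2) (C - bitsVal it.1) (by omega)
    rw [h, exists_mem_minCost, Reachable, ← ih₁, ← ih₂]
    refine or_congr ?_ ?_
    · cases it.2.2.1 <;> by_cases hw : it.2.1.1 ≤ v <;> simp [hw]
    · cases it.2.2.2 <;> by_cases hw : it.2.1.2 ≤ v <;> simp [hw]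
      cases (knapsackTable V items)[v - it.2.1.2]?.getD none with
      | none => simp
      | some c => simp [bitsVal_addBits]; omega

theorem knapsack_iff (items : List Item) (B : List Bool) (v : ℕ) :
    knapsack items B v = true ↔ Reachable items v (bitsVal B) := by
  rw [← exists_mem_knapsackTable (v + 1) items v _ (by omega), knapsack]
  cases (knapsackTable (v + 1) items).getD v none <;> simp [leBits_iff]

/-- A choice of values for the issues, as a function. -/
theorem reachable_ofFn {n : ℕ} (it : Fin n → Item) (v C : ℕ) :
    Reachable (List.ofFn it) v C ↔ ∃ r : Fin n → Bool,
      (∀ x, (if r x = true then (it x).2.2.2 else (it x).2.2.1) = true) ∧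
      ∑ x, (if r x = true then (it x).2.1.2 else (it x).2.1.1) = v ∧
      ∑ x, (if r x = true then bitsVal (it x).1 else 0) ≤ C := by
  induction n generalizing v C with
  | zero =>
    change v = 0 ↔ _
    simp only [IsEmpty.forall_iff, Finset.univ_eq_empty, Finset.sum_empty, Nat.zero_le, true_and,
      and_true]
    exact ⟨fun h => ⟨Fin.elim0, h.symm⟩, fun ⟨_, h⟩ => h.symm⟩
  | succ n ih =>
    rw [List.ofFn_succ, Reachable, ih, ih]
    constructor
    · rintro (⟨h₁, h₂, r, h₃, h₄, h₅⟩ | ⟨h₁, h₂, h₃, r, h₄, h₅, h₆⟩)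
      · refine ⟨Fin.cons false r, ?_, ?_, ?_⟩
        · exact Fin.cases (by simpa using h₁) (by simpa using h₃)
        · rw [Fin.sum_univ_succ]; simp [h₄]; omega
        · rw [Fin.sum_univ_succ]; simpa using h₅
      · refine ⟨Fin.cons true r, ?_, ?_, ?_⟩
        · exact Fin.cases (by simpa using h₁) (by simpa using h₄)
        · rw [Fin.sum_univ_succ]; simp [h₅]; omega
        · rw [Fin.sum_univ_succ]; simp; omega
    · rintro ⟨r, h₁, h₂, h₃⟩
      rw [Fin.sum_univ_succ] at h₂ h₃
      cases h₀ : r 0 with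
      | false =>
        have h := h₁ 0
        simp only [h₀] at h h₂ h₃
        simp at h h₂ h₃
        exact .inl ⟨h, by omega, fun x => r x.succ, fun x => h₁ x.succ, by simp; omega, by simpa⟩
      | true =>
        have h := h₁ 0
        simp only [h₀] at h h₂ h₃
        simp at h h₂ h₃
        exact .inr ⟨h, by omega, by omega, fun x => r x.succ, fun x => h₁ x.succ,
          by simp; omega, by simp; omega⟩

/-- The size of the table is polynomial, because adding up costs increases the number of digits
only slowly. -/
theorem size_knapsackTable_le (V : ℕ) (items : List Item) :
    size (knapsackTable V items) ≤ V * (4 * size items + 4) + 1 := by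
  have hbits (c : List Bool) : size c ≤ 4 * c.length + 1 := by
    induction c with
    | nil => simp
    | cons b c ih => cases b <;> simp <;> omega
  have hmin {x y : Option (List Bool)} {c : List Bool} (h : c ∈ minCost x y) : c ∈ x ∨ c ∈ y := by
    cases x with
    | none => exact .inr h
    | some a =>
      cases y with
      | none => exact .inl h
      | some b => cases hab : leBits a b <;> simp [minCost, hab] at h ⊢ <;> simp [h]
  have hcell : ∀ v, ∀ c ∈ (knapsackTable V items).getD v none, c.length + 1 ≤ size items := by
    induction items with
    | nil =>
      intro v c hc
      by_cases h : v < V <;>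
        by_cases h' : v = 0 <;>
          simp [knapsackTable, List.getD_eq_getElem?_getD, h, h'] at hc <;> simp_all
    | cons it items ih =>
      intro v c hc
      have h₀ : it.1.length + 1 ≤ size it := by
        have := length_le_size it.1
        obtain ⟨c, w, a⟩ := it
        have := size_pos (w, a)
        rw [size_pair]
        simp at *; omega
      rw [size_cons]
      by_cases hv : v < V
      · rw [show knapsackTable V (it :: items) = knapsackStep V it (knapsackTable V items) from rfl,
          knapsackStep, List.getD_eq_getElem?_getD, List.getElem?_map, List.getElem?_range hv] at hc
        rcases hmin hc with hc | hc
        · cases h : it.2.2.1 && decide (it.2.1.1 ≤ v) with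
          | false => simp [h] at hc
          | true =>
            rw [h] at hc
            have := ih _ _ hc
            omega
        · cases h : it.2.2.2 && decide (it.2.1.2 ≤ v) with
          | false => simp [h] at hc
          | true =>
            rw [h, cond_true] at hc
            cases hd : (knapsackTable V items).getD (v - it.2.1.2) none with
            | none => simp only [hd] at hc; simp at hc
            | some d =>
              have := ih _ _ hd
              simp only [hd] at hc
              simp at hc
              rw [← hc, length_addBits]
              omega
      · rw [show knapsackTable V (it :: items) = knapsackStep V it (knapsackTable V items) from rfl,
          knapsackStep, List.getD_eq_getElem?_getD, List.getElem?_eq_none (by simpa using hv)] at hc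
        simp at hc
  have hlen : (knapsackTable V items).length = V := by
    cases items <;> simp [knapsackTable, knapsackStep]
  refine (size_list_le (N := 4 * size items + 3) fun o ho => ?_).trans (by rw [hlen])
  obtain ⟨v, hv, rfl⟩ := List.getElem_of_mem ho
  cases h : (knapsackTable V items)[v] with
  | none => simp
  | some c =>
    have h₁ := hcell v c (by rw [List.getD_eq_getElem?_getD, List.getElem?_eq_getElem hv, h]; rfl)
    have h₂ := hbits c
    simp; omega

theorem polyTime_knapsackTable_aux :
    PolyTime fun x : ℕ × List Item => knapsackTable x.1 x.2 :=
  PolyTime.foldr (l := fun x : ℕ × List Item => x.2)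
    (i := fun x => (List.range x.1).map fun v => bif decide (v = 0) then some [] else none)
    (g := fun x it d => knapsackStep x.1 it d) (by fun_prop) (by fun_prop)
    (by unfold knapsackStep minCost; fun_prop) (.X * (4 * .X + 4) + 1) fun (V, items) l' hl' => by
      refine (size_knapsackTable_le V l').trans ?_
      have h : size l' ≤ size items := by
        obtain ⟨l, hl⟩ := hl'
        have := PolyTime.size_append l l'
        have := size_pos l
        simp only at hl
        rw [← hl]
        omega
      have h₁ : size l' ≤ size (V, items) := by simp; omega
      have h₂ : V ≤ size (V, items) := by simp; omega
      simp only [Polynomial.eval_add, Polynomial.eval_mul, Polynomial.eval_X,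
        Polynomial.eval_ofNat, Polynomial.eval_one]
      gcongr

section

variable {α : Type} [TreeCode α]

@[fun_prop] theorem polyTime_knapsack {items : α → List Item} {B : α → List Bool} {v : α → ℕ}
    (hi : PolyTime items) (hB : PolyTime B) (hv : PolyTime v) :
    PolyTime fun x => knapsack (items x) (B x) (v x) := by
  have h : PolyTime fun x => knapsackTable (v x + 1) (items x) :=
    polyTime_knapsackTable_aux.comp (f := fun x => (v x + 1, items x)) (by fun_prop)
  unfold knapsack
  fun_prop

end

/-! ### Weighted ballots under a budget constraint -/

/-- The issues as items of the dynamic program, for the costs `costs`, the weights `w` of the values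
`false` and `true` and the partial ballot `s`. -/
def budgetItems (costs : List (List Bool)) (w : List (ℕ × ℕ)) (s : List (Option Bool)) :
    List Item :=
  (List.range costs.length).map fun i => (costs.getD i [], w.getD i (0, 0),
    (!(s.getD i none).getD false, (s.getD i none).getD true))

/-- Is there a rational ballot of weight `v` with which `s` agrees? -/
def feasible (costs : List (List Bool)) (B : List Bool) (w : List (ℕ × ℕ))
    (s : List (Option Bool)) (v : ℕ) : Bool :=
  knapsack (budgetItems costs w s) B v

/-- Is there a rational ballot of maximal weight with which `s` agrees? -/
def optimal (costs : List (List Bool)) (B : List Bool) (w : List (ℕ × ℕ))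
    (s : List (Option Bool)) : Bool :=
  (List.range ((w.map fun a => a.1 + a.2).sum + 1)).any fun v => feasible costs B w s v &&
    (List.range ((w.map fun a => a.1 + a.2).sum + 1)).all fun v' =>
      decide (v' ≤ v) || !feasible costs B w [] v'

section

variable {α : Type} [TreeCode α] {costs : α → List (List Bool)} {B : α → List Bool}
  {w : α → List (ℕ × ℕ)} {s : α → List (Option Bool)} {v : α → ℕ}

@[fun_prop] theorem polyTime_feasible (hc : PolyTime costs) (hB : PolyTime B) (hw : PolyTime w)
    (hs : PolyTime s) (hv : PolyTime v) :
    PolyTime fun x => feasible (costs x) (B x) (w x) (s x) (v x) := by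
  unfold feasible budgetItems
  fun_prop

@[fun_prop] theorem polyTime_optimal (hc : PolyTime costs) (hB : PolyTime B) (hw : PolyTime w)
    (hs : PolyTime s) : PolyTime fun x => optimal (costs x) (B x) (w x) (s x) := by
  unfold optimal
  fun_prop

end

section

variable {n : ℕ}

/-- The costs in binary. -/
def costBits (c : Fin n → ℕ) : List (List Bool) := List.ofFn fun x => encodeNat (c x)

@[simp] theorem length_costBits (c : Fin n → ℕ) : (costBits c).length = n := by simp [costBits]

theorem getD_ofFn {α : Type} (f : Fin n → α) (x : Fin n) (d : α) :
    (List.ofFn f).getD x d = f x := by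
  simp [List.getD_eq_getElem?_getD]

theorem map_range_eq_ofFn {α : Type} (f : ℕ → α) :
    (List.range n).map f = List.ofFn fun x : Fin n => f x := by
  apply List.ext_getElem <;> simp

theorem feasible_iff (c : Fin n → ℕ) (B : ℕ) (w : Fin n → Bool → ℕ) (s : PartialBallot n)
    {wl : List (ℕ × ℕ)} {sl : List (Option Bool)}
    (hw : ∀ x : Fin n, wl.getD x (0, 0) = (w x false, w x true))
    (hs : ∀ x : Fin n, sl.getD x none = s x) (v : ℕ) :
    feasible (costBits c) (encodeNat B) wl sl v = true ↔
      ∃ r ∈ budgetConstraint c B, Agrees s r ∧ ∑ x, w x (r x) = v := by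
  rw [feasible, knapsack_iff, budgetItems, length_costBits, map_range_eq_ofFn, reachable_ofFn,
    bitsVal_encodeNat]
  refine exists_congr fun r => ?_
  have h₁ : (∀ x : Fin n, (if r x = true then (sl.getD x none).getD true
      else !(sl.getD x none).getD false) = true) ↔ Agrees s r := by
    refine forall_congr' fun x => ?_
    rw [hs]
    rcases s x with _ | _ | _ <;> cases r x <;> simp
  have h₂ : ∑ x : Fin n, (if r x = true then (wl.getD x (0, 0)).2 else (wl.getD x (0, 0)).1) =
      ∑ x, w x (r x) := by
    refine Finset.sum_congr rfl fun x _ => ?_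
    rw [hw]
    cases r x <;> rfl
  have h₃ : ∑ x : Fin n, (if r x = true then bitsVal ((costBits c).getD x []) else 0) =
      ∑ x with r x = true, c x := by
    rw [Finset.sum_filter]
    refine Finset.sum_congr rfl fun x _ => ?_
    rw [costBits, getD_ofFn, bitsVal_encodeNat]
  simp only [h₁, h₂, h₃, budgetConstraint, Set.mem_ofPred_eq]
  tauto

theorem optimal_iff (c : Fin n → ℕ) (B : ℕ) (w : Fin n → Bool → ℕ) (s : PartialBallot n) :
    optimal (costBits c) (encodeNat B) (List.ofFn fun x => (w x false, w x true))
      (List.ofFn s) = true ↔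
      ∃ r ∈ budgetConstraint c B, (∀ r' ∈ budgetConstraint c B,
        ∑ x, w x (r' x) ≤ ∑ x, w x (r x)) ∧ Agrees s r := by
  have hw (x : Fin n) : (List.ofFn fun x => (w x false, w x true)).getD x (0, 0) =
      (w x false, w x true) := getD_ofFn _ x _
  have h₁ := feasible_iff c B w s hw fun x => getD_ofFn s x none
  have h₂ := feasible_iff c B w (fun _ => none) hw (sl := []) fun x => by simp
  have hV (r : Ballot n) : ∑ x, w x (r x) <
      ((List.ofFn fun x => (w x false, w x true)).map fun a => a.1 + a.2).sum + 1 := by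
    rw [List.map_ofFn, List.sum_ofFn, Nat.lt_succ_iff]
    refine Finset.sum_le_sum fun x _ => ?_
    cases r x <;> simp
  have hnone (r : Ballot n) : Agrees (fun _ => none) r := fun x b h => by simp at h
  simp only [optimal, List.any_eq_true, List.all_eq_true, List.mem_range, Bool.and_eq_true,
    Bool.or_eq_true, decide_eq_true_eq, Bool.not_eq_true', ← Bool.not_eq_true, h₁, h₂]
  constructor
  · rintro ⟨_, _, ⟨r, hr, hs, rfl⟩, h⟩
    refine ⟨r, hr, fun r' hr' => ?_, hs⟩
    exact (h _ (hV r')).resolve_right fun h' => h' ⟨r', hr', hnone r', rfl⟩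
  · rintro ⟨r, hr, h, hs⟩
    refine ⟨_, hV r, ⟨r, hr, hs, rfl⟩, fun v' _ => ?_⟩
    by_cases hv : v' ≤ ∑ x, w x (r x)
    · exact .inl hv
    · refine .inr ?_
      rintro ⟨r', hr', -, rfl⟩
      exact hv (h r' hr')

/-! ### The scoring procedures -/

/-- The total score is a sum of weights of the issues. -/
theorem totalScore_eq (sc : Ballot n → Lit n → ℕ) (P : Profile n) (r : Ballot n) :
    totalScore sc P r = ∑ x, (P.map fun ri => sc ri (x, r x)).sum := by
  have h (f : Lit n → ℕ) : ∑ l : Lit n with Sat r l, f l = ∑ x, f (x, r x) := by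
    rw [Finset.sum_filter, Fintype.sum_prod_type]
    refine Finset.sum_congr rfl fun x _ => ?_
    cases h : r x <;> simp [Sat, h]
  unfold totalScore
  simp only [h]
  induction P with
  | nil => simp
  | cons ri P ih => simp [ih, Finset.sum_add_distrib]

/-- A ballot as a list. -/
def ballotBits (r : Ballot n) : List Bool := List.ofFn r

theorem getD_ballotBits (r : Ballot n) (x : Fin n) : (ballotBits r).getD x false = r x :=
  getD_ofFn _ _ _

end

/-- The weights of the issues that a scoring function `sc`, given for an issue and its value,
assigns to the values of the issues. -/
def scoreWeights (N : ℕ) (ballots : List (List Bool)) (sc : List Bool → ℕ → Bool → ℕ) :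
    List (ℕ × ℕ) :=
  (List.range N).map fun i =>
    ((ballots.map fun r => sc r i false).sum, (ballots.map fun r => sc r i true).sum)

theorem optimal_scoreWeights_iff {n : ℕ} (c : Fin n → ℕ) (B : ℕ) (P : Profile n)
    (s : PartialBallot n) (sc : Ballot n → Lit n → ℕ) (sc' : List Bool → ℕ → Bool → ℕ)
    (h : ∀ r ∈ P, ∀ (x : Fin n) (b : Bool), sc' (ballotBits r) x b = sc r (x, b)) :
    optimal (costBits c) (encodeNat B) (scoreWeights n (P.map ballotBits) sc')
      (List.ofFn s) = true ↔
      OutcomeQuestion (scoringRule (budgetConstraint c B) sc P) s := by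
  have hw : scoreWeights n (P.map ballotBits) sc' = List.ofFn fun x : Fin n =>
      ((P.map fun r => sc r (x, false)).sum, (P.map fun r => sc r (x, true)).sum) := by
    rw [scoreWeights, map_range_eq_ofFn]
    congr 1
    funext x
    simp only [List.map_map]
    congr 2 <;> exact List.map_congr_left fun r hr => h r hr x _
  rw [hw, optimal_iff c B fun x b => (P.map fun r => sc r (x, b)).sum]
  simp only [OutcomeQuestion, scoringRule, Set.mem_ofPred_eq, totalScore_eq, and_assoc]

/-- The score of the Kemeny procedure. -/
def kemenyScore (r : List Bool) (i : ℕ) (b : Bool) : ℕ := bif r.getD i false == b then 1 else 0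

/-- A decision procedure for the Kemeny procedure. -/
def kemenyOutcome (costs : List (List Bool)) (B : List Bool) (ballots : List (List Bool))
    (s : List (Option Bool)) : Bool :=
  optimal costs B (scoreWeights costs.length ballots kemenyScore) s

theorem kemenyOutcome_iff {n : ℕ} (c : Fin n → ℕ) (B : ℕ) (P : Profile n) (s : PartialBallot n) :
    kemenyOutcome (costBits c) (encodeNat B) (P.map ballotBits) (List.ofFn s) = true ↔
      OutcomeQuestion (kemeny (budgetConstraint c B) P) s := by
  rw [kemenyOutcome, length_costBits, kemeny, ← optimal_scoreWeights_iff]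
  intro r _ x b
  rw [kemenyScore, getD_ballotBits]
  by_cases h : r x = b <;> simp [Sat, h, Bool.cond_eq_ite]

/-- The reversal score: the least weight of a ballot with the reversed value of the issue, if every
difference to `r` has weight `1`. -/
def reversalBits (costs : List (List Bool)) (B : List Bool) (r : List Bool) (i : ℕ) (b : Bool) :
    ℕ :=
  ((List.range (costs.length + 1)).find? fun d => feasible costs B
    ((List.range costs.length).map fun j => bif r.getD j false then (1, 0) else (0, 1))
    ((List.range costs.length).map fun j => bif decide (j = i) then some (!b) else none) d).getD 0

/-- A decision procedure for the reversal scoring procedure. -/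
def reversalOutcome (costs : List (List Bool)) (B : List Bool) (ballots : List (List Bool))
    (s : List (Option Bool)) : Bool :=
  optimal costs B (scoreWeights costs.length ballots (reversalBits costs B)) s

theorem find?_range_getD_eq_sInf (p : ℕ → Bool) (N : ℕ) (h : ∀ d, p d = true → d < N) :
    ((List.range N).find? p).getD 0 = sInf {d | p d = true} := by
  cases hf : (List.range N).find? p with
  | none =>
    have : {d | p d = true} = ∅ := by
      refine Set.eq_empty_of_forall_notMem fun d hd => ?_
      exact List.find?_eq_none.1 hf d (List.mem_range.2 (h d hd)) hd
    simp [this]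
  | some d =>
    rw [List.find?_range_eq_some] at hf
    refine le_antisymm (le_csInf ⟨d, hf.1⟩ fun k hk => ?_) (Nat.sInf_le hf.1)
    by_contra hlt
    have := hf.2.2 k (by simpa using hlt)
    simp_all

theorem reversalBits_eq {n : ℕ} (c : Fin n → ℕ) (B : ℕ) (r : Ballot n) (x : Fin n) (b : Bool) :
    reversalBits (costBits c) (encodeNat B) (ballotBits r) x b =
      reversalScore (budgetConstraint c B) r (x, b) := by
  have hf := feasible_iff c B (fun y a => if r y = a then 0 else 1)
    (Function.update (fun _ => none) x (some !b))
    (wl := (List.range n).map fun j => bif (ballotBits r).getD j false then (1, 0) else (0, 1))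
    (sl := (List.range n).map fun j => bif decide (j = (x : ℕ)) then some (!b) else none)
    (fun y => by
      rw [map_range_eq_ofFn, getD_ofFn, getD_ballotBits]
      cases r y <;> rfl)
    (fun y => by
      rw [map_range_eq_ofFn, getD_ofFn, Function.update_apply]
      by_cases h : y = x <;> simp [h, Fin.val_inj])
  have hd (r' : Ballot n) : ∑ y, (if r y = r' y then 0 else 1) = hammingDist r r' := by
    rw [hammingDist, Finset.card_filter]
    exact Finset.sum_congr rfl fun y _ => by by_cases h : r y = r' y <;> simp [h]
  have ha (r' : Ballot n) : Agrees (Function.update (fun _ => none) x (some !b)) r' ↔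
      ¬ Sat r' (x, b) := by
    constructor
    · intro h
      have := h x (!b) (by simp)
      simp [this]
    · intro h y a hy
      by_cases hyx : y = x
      · subst hyx
        simp at hy h
        cases b <;> simp_all
      · simp [hyx] at hy
  simp only [hd, ha] at hf
  rw [reversalBits, length_costBits, find?_range_getD_eq_sInf, reversalScore]
  · simp only [hf]
  · intro d hd'
    rw [hf] at hd'
    obtain ⟨r', -, -, rfl⟩ := hd'
    exact Nat.lt_succ_of_le (hammingDist_le_card_fintype.trans (by simp))

theorem reversalOutcome_iff {n : ℕ} (c : Fin n → ℕ) (B : ℕ) (P : Profile n) (s : PartialBallot n) :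
    reversalOutcome (costBits c) (encodeNat B) (P.map ballotBits) (List.ofFn s) = true ↔
      OutcomeQuestion (reversalScoring (budgetConstraint c B) P) s := by
  rw [reversalOutcome, length_costBits, reversalScoring, ← optimal_scoreWeights_iff]
  exact fun r _ x b => reversalBits_eq c B r x b

/-! ### The Slater procedure -/

/-- The majority strength of a literal. -/
def strengthBits (ballots : List (List Bool)) (i : ℕ) (b : Bool) : ℕ :=
  (ballots.filter fun r => r.getD i false == b).length

theorem strengthBits_eq {n : ℕ} (P : Profile n) (x : Fin n) (b : Bool) :
    strengthBits (P.map ballotBits) x b = majorityStrength P (x, b) := by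
  rw [strengthBits, majorityStrength, ← List.countP_eq_length_filter, List.countP_map]
  refine List.countP_congr fun r _ => ?_
  simp only [Function.comp, getD_ballotBits]
  simp

/-- The value `b` of the issue `i` has weight `1` if a strict majority is for it. -/
def slaterWeight (ballots : List (List Bool)) (i : ℕ) (b : Bool) : ℕ :=
  bif decide (ballots.length < strengthBits ballots i b + strengthBits ballots i b) then 1 else 0

/-- A decision procedure for the Slater procedure. -/
def slaterOutcome (costs : List (List Bool)) (B : List Bool) (ballots : List (List Bool))
    (s : List (Option Bool)) : Bool :=
  optimal costs B ((List.range costs.length).map fun i =>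
    (slaterWeight ballots i false, slaterWeight ballots i true)) s

theorem majorityStrength_add {n : ℕ} (P : Profile n) (x : Fin n) :
    majorityStrength P (x, true) + majorityStrength P (x, false) = P.length := by
  rw [List.length_eq_countP_add_countP (fun r => decide (Sat r (x, true)))]
  simp [majorityStrength, Sat]

theorem slaterOutcome_iff {n : ℕ} (c : Fin n → ℕ) (B : ℕ) (P : Profile n) (s : PartialBallot n) :
    slaterOutcome (costBits c) (encodeNat B) (P.map ballotBits) (List.ofFn s) = true ↔
      OutcomeQuestion (slater (budgetConstraint c B) P) s := by
  rw [slaterOutcome, length_costBits, map_range_eq_ofFn,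
    optimal_iff c B fun (x : Fin n) b => slaterWeight (P.map ballotBits) x b]
  have hw (x : Fin n) (b : Bool) : slaterWeight (P.map ballotBits) x b =
      if majorityOutcome P x = some b then 1 else 0 := by
    have := majorityStrength_add P x
    rw [slaterWeight, strengthBits_eq, List.length_map, majorityOutcome, Bool.cond_decide]
    cases b <;> split_ifs <;> first | omega | simp_all
  have hd (r : Ballot n) : hammingDist (fun x => some (r x)) (majorityOutcome P) +
      ∑ x : Fin n, slaterWeight (P.map ballotBits) x (r x) = n := by
    simp only [hw, hammingDist, Finset.card_filter]
    rw [← Finset.sum_add_distrib]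
    have (x : Fin n) : (if some (r x) ≠ majorityOutcome P x then 1 else 0) +
        (if majorityOutcome P x = some (r x) then 1 else 0) = 1 := by
      by_cases h : majorityOutcome P x = some (r x) <;> simp [h, eq_comm]
    simp only [this]
    simp
  have hle (r r' : Ballot n) : ∑ x : Fin n, slaterWeight (P.map ballotBits) x (r' x) ≤
      ∑ x : Fin n, slaterWeight (P.map ballotBits) x (r x) ↔
      hammingDist (fun x => some (r x)) (majorityOutcome P) ≤
        hammingDist (fun x => some (r' x)) (majorityOutcome P) := by
    have h₁ := hd r
    have h₂ := hd r'
    omega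
  simp only [OutcomeQuestion, slater, Set.mem_ofPred_eq, hle, and_assoc]

section

variable {α : Type} [TreeCode α] {costs : α → List (List Bool)} {B : α → List Bool}
  {ballots : α → List (List Bool)} {s : α → List (Option Bool)}

@[fun_prop] theorem polyTime_kemenyOutcome (hc : PolyTime costs) (hB : PolyTime B)
    (hb : PolyTime ballots) (hs : PolyTime s) :
    PolyTime fun x => kemenyOutcome (costs x) (B x) (ballots x) (s x) := by
  unfold kemenyOutcome scoreWeights kemenyScore
  fun_prop

@[fun_prop] theorem polyTime_reversalOutcome (hc : PolyTime costs) (hB : PolyTime B)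
    (hb : PolyTime ballots) (hs : PolyTime s) :
    PolyTime fun x => reversalOutcome (costs x) (B x) (ballots x) (s x) := by
  unfold reversalOutcome scoreWeights reversalBits
  fun_prop

@[fun_prop] theorem polyTime_strengthBits {i : α → ℕ} {b : α → Bool} (hb : PolyTime ballots)
    (hi : PolyTime i) (hv : PolyTime b) :
    PolyTime fun x => strengthBits (ballots x) (i x) (b x) := by
  unfold strengthBits
  fun_prop

@[fun_prop] theorem polyTime_slaterOutcome (hc : PolyTime costs) (hB : PolyTime B)
    (hb : PolyTime ballots) (hs : PolyTime s) :
    PolyTime fun x => slaterOutcome (costs x) (B x) (ballots x) (s x) := by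
  unfold slaterOutcome slaterWeight
  fun_prop

end

/-! ### The ranked agenda procedure -/

/-- Set the issue of the literal `l` to its sign. -/
def setLit (N : ℕ) (s : List (Option Bool)) (l : ℕ × Bool) : List (Option Bool) :=
  (List.range N).map fun j => bif decide (j = l.1) then some l.2 else s.getD j none

/-- One step of the ranked agenda procedure. -/
def agendaStep (costs : List (List Bool)) (B : List Bool) (s : List (Option Bool)) (l : ℕ × Bool) :
    List (Option Bool) :=
  bif !((s.getD l.1 none).elim false fun a => a == !l.2) &&
    feasible costs B [] (setLit costs.length s l) 0 then setLit costs.length s l else s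

/-- The literals by decreasing majority strength, where `lits` is the tie-breaking order. -/
def agenda (ballots : List (List Bool)) (lits : List (ℕ × Bool)) : List (ℕ × Bool) :=
  (List.range (ballots.length + 1)).reverse.flatMap fun k =>
    lits.filter fun l => decide (strengthBits ballots l.1 l.2 = k)

/-- A decision procedure for the ranked agenda procedure. It also checks that the partial ballot
reached in the end is complete. -/
def rankedOutcome (costs : List (List Bool)) (B : List Bool) (ballots : List (List Bool))
    (s : List (Option Bool)) (lits : List (ℕ × Bool)) : Bool :=
  (List.range costs.length).all fun j =>
    (((agenda ballots lits).foldl (agendaStep costs B)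
      ((List.range costs.length).map fun _ => none)).getD j none).elim false fun a =>
        (s.getD j none).elim true fun b => a == b

section

variable {n : ℕ}

/-- A literal with the number of its issue. -/
def litBits (l : Lit n) : ℕ × Bool := (l.1, l.2)

theorem agendaStep_eq (c : Fin n → ℕ) (B : ℕ) (s : PartialBallot n) (l : Lit n) :
    agendaStep (costBits c) (encodeNat B) (List.ofFn s) (litBits l) =
      List.ofFn (rankedStep (budgetConstraint c B) s l) := by
  have h₁ : setLit n (List.ofFn s) (litBits l) =
      List.ofFn (Function.update s l.1 (some l.2)) := by
    rw [setLit, map_range_eq_ofFn]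
    congr 1
    funext x
    rw [getD_ofFn, Function.update_apply]
    by_cases h : x = l.1 <;> simp [litBits, h, Fin.val_inj]
  have h₂ := feasible_iff c B (fun _ _ => 0) (Function.update s l.1 (some l.2)) (wl := [])
    (fun x => by simp) (fun x => getD_ofFn _ x none) 0
  have h₃ : (((List.ofFn s).getD (litBits l).1 none).elim false fun a => a == !(litBits l).2) =
      decide (s l.1 = some !l.2) := by
    rw [litBits, getD_ofFn]
    cases s l.1 with
    | none => simp
    | some a => simp only [Option.elim_some, Option.some.injEq]; cases a <;> cases l.2 <;> rfl
  rw [agendaStep, length_costBits, h₁, h₃, rankedStep]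
  simp only [Finset.sum_const_zero, and_true] at h₂
  by_cases hs : s l.1 = some !l.2
  · simp [hs]
  · by_cases hf : feasible (costBits c) (encodeNat B) []
        (List.ofFn (Function.update s l.1 (some l.2))) 0 = true
    · rw [if_pos ⟨hs, h₂.1 hf⟩]
      simp [hs, hf]
    · rw [if_neg fun h => hf (h₂.2 h.2)]
      simp [hs, hf]

theorem foldl_agendaStep_eq (c : Fin n → ℕ) (B : ℕ) (L : List (Lit n)) (s : PartialBallot n) :
    (L.map litBits).foldl (agendaStep (costBits c) (encodeNat B)) (List.ofFn s) =
      List.ofFn (L.foldl (rankedStep (budgetConstraint c B)) s) := by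
  induction L generalizing s with
  | nil => rfl
  | cons l L ih => simp [agendaStep_eq, ih]

/-- The agenda as a list of literals. -/
def agendaLits (P : Profile n) (L : List (Lit n)) : List (Lit n) :=
  (List.range (P.length + 1)).reverse.flatMap fun k =>
    L.filter fun l => decide (majorityStrength P l = k)

theorem agenda_eq (P : Profile n) (L : List (Lit n)) :
    agenda (P.map ballotBits) (L.map litBits) = (agendaLits P L).map litBits := by
  rw [agenda, agendaLits, List.length_map, List.map_flatMap]
  congr 1
  funext k
  rw [List.filter_map]
  congr 2
  funext l
  simp [litBits, strengthBits_eq]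

theorem mem_agendaLits (P : Profile n) {L : List (Lit n)} {l : Lit n} (h : l ∈ L) :
    l ∈ agendaLits P L := by
  simp only [agendaLits, List.mem_flatMap, List.mem_reverse, List.mem_range, List.mem_filter]
  exact ⟨majorityStrength P l, Nat.lt_succ_of_le List.countP_le_length, h, by simp⟩

theorem pairwise_agendaLits (tb : Lit n → Lit n → Prop) (P : Profile n) {L : List (Lit n)}
    (h : L.Pairwise tb) : (agendaLits P L).Pairwise (Precedes tb P) := by
  rw [agendaLits, List.pairwise_flatMap]
  constructor
  · intro k _
    rw [List.pairwise_filter]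
    refine h.imp fun {l l'} hll' hl hl' => .inr ⟨?_, hll'⟩
    simp at hl hl'
    rw [hl, hl']
  · rw [List.pairwise_reverse]
    refine List.pairwise_lt_range.imp fun {k k'} hk l hl l' hl' => .inl ?_
    simp at hl hl'
    omega

theorem Precedes.asymm {tb : Lit n → Lit n → Prop} (htb : ∀ l l', tb l l' → ¬ tb l' l)
    {P : Profile n} {l l' : Lit n} (h : Precedes tb P l l') : ¬ Precedes tb P l' l := by
  unfold Precedes at *
  have := htb l l'
  rintro (h' | h') <;> rcases h with h | h
  · omega
  · omega
  · omega
  · exact this h.2 h'.2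

/-- There is only one list of all literals that is in the order of the agenda. -/
theorem eq_of_pairwise_precedes {tb : Lit n → Lit n → Prop} (htb : ∀ l l', tb l l' → ¬ tb l' l)
    {P : Profile n} {L L' : List (Lit n)} (hL : ∀ l, l ∈ L) (hL' : ∀ l, l ∈ L')
    (h : L.Pairwise (Precedes tb P)) (h' : L'.Pairwise (Precedes tb P)) : L = L' := by
  have hne {l l' : Lit n} (hll' : Precedes tb P l l') : l ≠ l' := by
    rintro rfl
    exact hll'.asymm htb hll'
  have hp : L.Perm L' := (List.perm_ext_iff_of_nodup (h.imp hne) (h'.imp hne)).2 fun l =>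
    ⟨fun _ => hL' l, fun _ => hL l⟩
  exact hp.eq_of_pairwise (fun _ _ _ _ h₁ h₂ => (h₁.asymm htb h₂).elim) h h'

theorem rankedOutcome_iff (c : Fin n → ℕ) (B : ℕ) (P : Profile n) (s : PartialBallot n)
    (L : List (Lit n)) (hL : ∀ l, l ∈ L) (tb : Lit n → Lit n → Prop)
    (htb : ∀ l l', tb l l' → ¬ tb l' l) (hp : L.Pairwise tb) :
    rankedOutcome (costBits c) (encodeNat B) (P.map ballotBits) (List.ofFn s)
      (L.map litBits) = true ↔
      OutcomeQuestion (rankedAgenda tb (budgetConstraint c B) P) s := by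
  have h₀ : (List.range n).map (fun _ => (none : Option Bool)) = List.ofFn fun _ : Fin n => none :=
    map_range_eq_ofFn _
  have h₁ (x : Fin n) : ((List.ofFn ((agendaLits P L).foldl (rankedStep (budgetConstraint c B))
      fun _ => none)).getD x none).elim false (fun a =>
        ((List.ofFn s).getD x none).elim true fun b => a == b) = true ↔
      ∃ a, (agendaLits P L).foldl (rankedStep (budgetConstraint c B)) (fun _ => none) x = some a ∧
        ∀ b, s x = some b → a = b := by
    rw [getD_ofFn, getD_ofFn]
    cases (agendaLits P L).foldl (rankedStep (budgetConstraint c B)) (fun _ => none) x <;>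
      cases s x <;> simp
  rw [rankedOutcome, length_costBits, agenda_eq, h₀, foldl_agendaStep_eq, List.all_eq_true]
  constructor
  · intro h
    choose r hr hs using fun x : Fin n => (h₁ x).1 (h x (List.mem_range.2 x.2))
    exact ⟨r, ⟨agendaLits P L, fun l => mem_agendaLits P (hL l), pairwise_agendaLits tb P hp,
      funext hr⟩, fun x b hb => hs x b hb⟩
  · rintro ⟨r, ⟨L', hL', hp', hr⟩, hs⟩ j hj
    rw [eq_of_pairwise_precedes htb hL' (fun l => mem_agendaLits P (hL l)) hp'
      (pairwise_agendaLits tb P hp)] at hr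
    exact (h₁ ⟨j, List.mem_range.1 hj⟩).2 ⟨_, congrFun hr _, fun b hb => hs _ b hb⟩

end

theorem polyTime_agendaStep_aux :
    PolyTime fun x : (List (List Bool) × List Bool) × List (Option Bool) × (ℕ × Bool) =>
      agendaStep x.1.1 x.1.2 x.2.1 x.2.2 := by
  unfold agendaStep setLit
  fun_prop

section

variable {α : Type} [TreeCode α] {costs : α → List (List Bool)} {B : α → List Bool}
  {ballots : α → List (List Bool)} {s : α → List (Option Bool)} {lits : α → List (ℕ × Bool)}

@[fun_prop] theorem polyTime_agenda (hb : PolyTime ballots) (hl : PolyTime lits) :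
    PolyTime fun x => agenda (ballots x) (lits x) := by
  unfold agenda
  fun_prop

theorem polyTime_foldl_agendaStep (hc : PolyTime costs) (hB : PolyTime B) (hb : PolyTime ballots)
    (hl : PolyTime lits) : PolyTime fun x => (agenda (ballots x) (lits x)).foldl
      (agendaStep (costs x) (B x)) ((List.range (costs x).length).map fun _ => none) := by
  obtain ⟨q, hq⟩ := hc.exists_size_le
  have hg : PolyTime fun p : α × List (Option Bool) × (ℕ × Bool) =>
      agendaStep (costs p.1) (B p.1) p.2.1 p.2.2 :=
    polyTime_agendaStep_aux.comp
      (f := fun p : α × List (Option Bool) × (ℕ × Bool) => ((costs p.1, B p.1), p.2.1, p.2.2))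
      (by fun_prop)
  refine PolyTime.foldl_of_max (g := fun x s l => agendaStep (costs x) (B x) s l)
    (polyTime_agenda hb hl) (by fun_prop) hg (q * 6 + 1) fun x s l => ?_
  have h : size (setLit (costs x).length s l) ≤ (q * 6 + 1).eval (size x) := by
    refine (size_list_le (N := 5) fun o _ => ?_).trans ?_
    · rcases o with _ | _ | _ <;> simp
    · have h₁ := (length_le_size (costs x)).trans (hq x)
      simp [setLit]; omega
  unfold agendaStep
  cases !((s.getD l.1 none).elim false fun a => a == !l.2) &&
    feasible (costs x) (B x) [] (setLit (costs x).length s l) 0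
  · exact le_max_left _ _
  · exact h.trans (le_max_right _ _)

@[fun_prop] theorem polyTime_rankedOutcome (hc : PolyTime costs) (hB : PolyTime B)
    (hb : PolyTime ballots) (hs : PolyTime s) (hl : PolyTime lits) :
    PolyTime fun x => rankedOutcome (costs x) (B x) (ballots x) (s x) (lits x) := by
  have h {F : α → List (Option Bool)} (hF : PolyTime F) :
      PolyTime fun x => (List.range (costs x).length).all fun j =>
        ((F x).getD j none).elim false fun a => ((s x).getD j none).elim true fun b => a == b := by
    fun_prop
  exact h (polyTime_foldl_agendaStep hc hB hb hl)

end

/-! ### Reading an instance -/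

/-- Is the symbol a comma? -/
def isComma : Γ' → Bool
  | .comma => true
  | _ => false

/-- Is the symbol a bracket? -/
def isBracket : Γ' → Bool
  | .bra => true
  | .ket => true
  | _ => false

/-- The entry of a partial ballot that a symbol stands for. -/
def entry : Γ' → Option Bool
  | .bit b => some b
  | _ => none

/-- Read a symbol, from the end of the word to its beginning. The brackets divide the word into
groups and the commas end the tokens in a group. -/
def parseStep (s : List (List (List (Option Bool)))) (a : Γ') : List (List (List (Option Bool))) :=
  bif isComma a then ([] :: s.head?.getD []) :: s.tail
  else bif isBracket a then [] :: s
  else ((entry a :: (s.head?.getD []).head?.getD []) :: (s.head?.getD []).tail) :: s.tail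

/-- The groups of tokens of the reversed word. -/
def parse (w : List Γ') : List (List (List (Option Bool))) := w.foldl parseStep [[]]

@[fun_prop] theorem polyTime_parse : PolyTime parse := by
  have h (f : Bool × Bool × Option Bool → Bool) (hf : PolyTime f) : PolyTime fun a : Γ' =>
      f (isComma a, isBracket a, entry a) :=
    hf.comp (.of_word_eq fun a => by rcases a with _ | _ | _ | _ | _ <;> rfl)
  have h₁ : PolyTime isComma := h (fun x => x.1) (by fun_prop)
  have h₂ : PolyTime isBracket := h (fun x => x.2.1) (by fun_prop)
  have h₃ : PolyTime entry := (PolyTime.snd_aux.comp PolyTime.snd_aux).comp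
    (.of_word_eq (f := fun a => (isComma a, isBracket a, entry a))
      fun a => by rcases a with _ | _ | _ | _ | _ <;> rfl)
  refine PolyTime.foldl_of_additive (g := fun _ s a => parseStep s a) .id (.const _)
    (by unfold parseStep; fun_prop) 12 fun w s a _ => ?_
  have ha : size (entry a) ≤ 5 := by rcases a with _ | (_ | _) | _ | _ | _ <;> simp [entry]
  rw [Polynomial.eval_ofNat]
  unfold parseStep
  cases isComma a
  · cases isBracket a
    · rcases s with _ | ⟨_ | ⟨t, g⟩, s⟩ <;> simp <;> omega
    · simp; omega
  · rcases s with _ | ⟨g, s⟩ <;> simp; omega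

/-- The groups of tokens of a word, read from the end, on top of the groups `s`. -/
def parseOn (w : List Γ') (s : List (List (List (Option Bool)))) :
    List (List (List (Option Bool))) :=
  w.foldr (fun a s => parseStep s a) s

theorem parse_reverse (w : List Γ') : parse w.reverse = parseOn w [[]] := by
  rw [parse, List.foldl_reverse]; rfl

theorem parseOn_append (w w' : List Γ') (s) : parseOn (w ++ w') s = parseOn w (parseOn w' s) :=
  List.foldr_append

theorem parseOn_token {α : Type} (l : List α) (f : α → Γ') (h : ∀ a, isComma (f a) = false)
    (h' : ∀ a, isBracket (f a) = false) (g : List (List (Option Bool))) (s) :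
    parseOn (l.map f ++ [.comma]) (g :: s) = ((l.map fun a => entry (f a)) :: g) :: s := by
  induction l with
  | nil => rfl
  | cons a l ih =>
    have : parseOn ((a :: l).map f ++ [.comma]) (g :: s) =
        parseStep (parseOn (l.map f ++ [.comma]) (g :: s)) (f a) := rfl
    rw [this, ih, parseStep, h, h']
    rfl

theorem parseOn_encodeNumber (m : ℕ) (g : List (List (Option Bool))) (s) :
    parseOn (encodeNumber m) (g :: s) = ((encodeNat m).map some :: g) :: s :=
  parseOn_token _ _ (fun _ => rfl) (fun _ => rfl) g s

theorem parseOn_encodeBallot {n : ℕ} (r : Ballot n) (g : List (List (Option Bool))) (s) :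
    parseOn (encodeBallot r) (g :: s) = ((ballotBits r).map some :: g) :: s :=
  parseOn_token _ _ (fun _ => rfl) (fun _ => rfl) g s

theorem parseOn_encodePartialBallot {n : ℕ} (r : PartialBallot n) (g : List (List (Option Bool)))
    (s) : parseOn (encodePartialBallot r) (g :: s) = (List.ofFn r :: g) :: s := by
  rw [encodePartialBallot, parseOn_token _ _ (fun o => by cases o <;> rfl)
    (fun o => by cases o <;> rfl)]
  congr 2
  conv_rhs => rw [← List.map_id (List.ofFn r)]
  exact List.map_congr_left fun o _ => by cases o <;> rfl

theorem parseOn_encodeLit {n : ℕ} (l : Lit n) (g : List (List (Option Bool))) (s) :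
    parseOn (encodeLit l) (g :: s) = ((some l.2 :: (encodeNat l.1).map some) :: g) :: s := by
  have : parseOn (encodeLit l) (g :: s) =
      parseStep (parseOn (encodeNumber l.1) (g :: s)) (.bit l.2) := rfl
  rw [this, parseOn_encodeNumber]
  rfl

theorem parseOn_encodeSeq {α : Type} (e : α → List Γ') (t : α → List (Option Bool))
    (h : ∀ a g s, parseOn (e a) (g :: s) = (t a :: g) :: s) (L : List α) (s) :
    parseOn (encodeSeq e L) s = [] :: L.map t :: s := by
  have h' : parseOn (L.flatMap e) ([] :: s) = L.map t :: s := by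
    induction L with
    | nil => rfl
    | cons a L ih => rw [List.flatMap_cons, parseOn_append, ih, h]; rfl
  have : parseOn (encodeSeq e L) s = [] :: parseOn (L.flatMap e ++ [.ket]) s := rfl
  rw [this, parseOn_append, ← h']
  rfl

/-- The groups of tokens of an instance. -/
theorem parseOn_encode (I : BudgetInstance) (s) :
    parseOn I.encode ([] :: s) = [(encodeNat I.budget).map some] ::
      (costBits I.cost).map (List.map some) :: [] ::
      (I.profile.map ballotBits).map (List.map some) :: [List.ofFn I.target] :: s := by
  rw [BudgetInstance.encode, parseOn_append, parseOn_append, parseOn_append,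
    parseOn_encodePartialBallot, parseOn_encodeSeq _ _ parseOn_encodeBallot,
    parseOn_encodeSeq _ _ fun m => parseOn_encodeNumber m, parseOn_encodeNumber]
  simp [costBits, List.map_ofFn, Function.comp_def]

/-- The bits of a token. -/
def tokenBits (t : List (Option Bool)) : List Bool := t.map fun o => o.getD false

@[simp] theorem tokenBits_map_some (l : List Bool) : tokenBits (l.map some) = l := by
  simp [tokenBits, Function.comp_def]

/-- The budget in a parsed word. -/
def readBudget (s : List (List (List (Option Bool)))) : List Bool :=
  tokenBits ((s.getD 0 []).getD 0 [])

/-- The costs in a parsed word. -/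
def readCosts (s : List (List (List (Option Bool)))) : List (List Bool) :=
  (s.getD 1 []).map tokenBits

/-- The profile in a parsed word. -/
def readBallots (s : List (List (List (Option Bool)))) : List (List Bool) :=
  (s.getD 3 []).map tokenBits

/-- The partial ballot in a parsed word. -/
def readTarget (s : List (List (List (Option Bool)))) : List (Option Bool) :=
  (s.getD 4 []).getD 0 []

/-- The minimum of `N` and of a number in binary, in unary. Stopping at `N` keeps the unary numbers
small. -/
def bitsToUnary (N : ℕ) (l : List Bool) : ℕ :=
  l.foldr (fun b v => ((bif b then 1 else 0) + (v + v)) - (((bif b then 1 else 0) + (v + v)) - N)) 0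

/-- The tie-breaking order in a parsed word. -/
def readLits (s : List (List (List (Option Bool)))) : List (ℕ × Bool) :=
  (s.getD 5 []).map fun t => (bitsToUnary (s.getD 1 []).length (tokenBits t.tail),
    (t.head?.getD none).getD false)

theorem bitsToUnary_eq (N : ℕ) (l : List Bool) : bitsToUnary N l = min (bitsVal l) N := by
  induction l with
  | nil => simp [bitsToUnary]
  | cons b l ih =>
    have : bitsToUnary N (b :: l) = ((bif b then 1 else 0) + (bitsToUnary N l + bitsToUnary N l)) -
      (((bif b then 1 else 0) + (bitsToUnary N l + bitsToUnary N l)) - N) := rfl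
    rw [this, ih]
    cases b <;> simp <;> omega

theorem polyTime_bitsToUnary_aux : PolyTime fun x : ℕ × List Bool => bitsToUnary x.1 x.2 :=
  PolyTime.foldr (l := fun x : ℕ × List Bool => x.2) (i := fun _ => 0)
    (g := fun x b v => ((bif b then 1 else 0) + (v + v)) -
      (((bif b then 1 else 0) + (v + v)) - x.1)) (by fun_prop) (by fun_prop) (by fun_prop) .X
    fun (N, l) l' _ => by
      have h := bitsToUnary_eq N l'
      have h' : size (bitsToUnary N l') ≤ size (N, l) := by
        simp [h]; omega
      rw [Polynomial.eval_X]
      exact h'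

section

variable {α : Type} [TreeCode α] {s : α → List (List (List (Option Bool)))}

@[fun_prop] theorem polyTime_tokenBits {t : α → List (Option Bool)} (ht : PolyTime t) :
    PolyTime fun x => tokenBits (t x) := by
  unfold tokenBits
  fun_prop

@[fun_prop] theorem polyTime_bitsToUnary {N : α → ℕ} {l : α → List Bool} (hN : PolyTime N)
    (hl : PolyTime l) : PolyTime fun x => bitsToUnary (N x) (l x) :=
  polyTime_bitsToUnary_aux.comp (hN.pair hl)

@[fun_prop] theorem polyTime_readBudget (hs : PolyTime s) : PolyTime fun x => readBudget (s x) := by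
  unfold readBudget
  fun_prop

@[fun_prop] theorem polyTime_readCosts (hs : PolyTime s) : PolyTime fun x => readCosts (s x) := by
  unfold readCosts
  fun_prop

@[fun_prop] theorem polyTime_readBallots (hs : PolyTime s) :
    PolyTime fun x => readBallots (s x) := by
  unfold readBallots
  fun_prop

@[fun_prop] theorem polyTime_readTarget (hs : PolyTime s) : PolyTime fun x => readTarget (s x) := by
  unfold readTarget
  fun_prop

@[fun_prop] theorem polyTime_readLits (hs : PolyTime s) : PolyTime fun x => readLits (s x) := by
  unfold readLits
  fun_prop

end

theorem read_encode (I : BudgetInstance) :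
    readBudget (parse I.encode.reverse) = encodeNat I.budget ∧
    readCosts (parse I.encode.reverse) = costBits I.cost ∧
    readBallots (parse I.encode.reverse) = I.profile.map ballotBits ∧
    readTarget (parse I.encode.reverse) = List.ofFn I.target := by
  rw [parse_reverse, parseOn_encode]
  refine ⟨?_, ?_, ?_, ?_⟩
  · simp [readBudget]
  · simp [readCosts, Function.comp_def]
  · simp [readBallots, Function.comp_def]
  · simp [readTarget]

theorem read_encode_ranked (I : RankedBudgetInstance) :
    readBudget (parse I.encode.reverse) = encodeNat I.budget ∧
    readCosts (parse I.encode.reverse) = costBits I.cost ∧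
    readBallots (parse I.encode.reverse) = I.profile.map ballotBits ∧
    readTarget (parse I.encode.reverse) = List.ofFn I.target ∧
    readLits (parse I.encode.reverse) = (List.ofFn I.tieBreak).map litBits := by
  rw [parse_reverse, RankedBudgetInstance.encode, parseOn_append,
    parseOn_encodeSeq _ _ parseOn_encodeLit, parseOn_encode]
  refine ⟨?_, ?_, ?_, ?_, ?_⟩
  · simp [readBudget]
  · simp [readCosts, Function.comp_def]
  · simp [readBallots, Function.comp_def]
  · simp [readTarget]
  · simp [readLits, Function.comp_def, bitsToUnary_eq, bitsVal_encodeNat, litBits]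

/-! ### Polynomial-time decidability of the four procedures -/

theorem polyTimeDecidable_of_lists
    (F : List (List Bool) → List Bool → List (List Bool) → List (Option Bool) → Bool)
    (hF : PolyTime fun w => F (readCosts (parse w)) (readBudget (parse w)) (readBallots (parse w))
      (readTarget (parse w))) {Q : BudgetInstance → Prop}
    (h : ∀ I : BudgetInstance, F (costBits I.cost) (encodeNat I.budget) (I.profile.map ballotBits)
      (List.ofFn I.target) = true ↔ Q I) : PolyTimeDecidable BudgetInstance.encode Q :=
  ⟨_, h, hF.tm2ComputableInPolyTime fun I => by
    obtain ⟨h₁, h₂, h₃, h₄⟩ := read_encode I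
    rw [h₁, h₂, h₃, h₄]⟩

theorem polyTimeDecidable_kemeny : PolyTimeDecidable BudgetInstance.encode fun I =>
    OutcomeQuestion (kemeny I.constraint I.profile) I.target :=
  polyTimeDecidable_of_lists kemenyOutcome (by fun_prop) fun _ => kemenyOutcome_iff ..

theorem polyTimeDecidable_slater : PolyTimeDecidable BudgetInstance.encode fun I =>
    OutcomeQuestion (slater I.constraint I.profile) I.target :=
  polyTimeDecidable_of_lists slaterOutcome (by fun_prop) fun _ => slaterOutcome_iff ..

theorem polyTimeDecidable_reversalScoring : PolyTimeDecidable BudgetInstance.encode fun I =>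
    OutcomeQuestion (reversalScoring I.constraint I.profile) I.target :=
  polyTimeDecidable_of_lists reversalOutcome (by fun_prop) fun _ => reversalOutcome_iff ..

theorem polyTimeDecidable_rankedAgenda : PolyTimeDecidable RankedBudgetInstance.encode fun I =>
    OutcomeQuestion (rankedAgenda I.tb I.constraint I.profile) I.target := by
  refine ⟨fun I => rankedOutcome (costBits I.cost) (encodeNat I.budget) (I.profile.map ballotBits)
    (List.ofFn I.target) ((List.ofFn I.tieBreak).map litBits), fun I => ?_, ?_⟩
  · refine rankedOutcome_iff _ _ _ _ _ (fun l => ?_) I.tb (fun l l' h => lt_asymm h) ?_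
    · exact List.mem_ofFn.2 (I.tieBreak.surjective l)
    · rw [List.pairwise_ofFn]
      intro i j hij
      simpa [RankedBudgetInstance.tb] using hij
  · have hF : PolyTime fun w => rankedOutcome (readCosts (parse w)) (readBudget (parse w))
        (readBallots (parse w)) (readTarget (parse w)) (readLits (parse w)) := by fun_prop
    refine hF.tm2ComputableInPolyTime fun I => ?_
    obtain ⟨h₁, h₂, h₃, h₄, h₅⟩ := read_encode_ranked I
    rw [h₁, h₂, h₃, h₄, h₅]

end JudgmentAggregation

theorem mainTheorem7 :
    JudgmentAggregation.PolyTimeDecidable JudgmentAggregation.BudgetInstance.encode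
      (fun I => JudgmentAggregation.OutcomeQuestion
        (JudgmentAggregation.kemeny I.constraint I.profile) I.target) ∧
    JudgmentAggregation.PolyTimeDecidable JudgmentAggregation.BudgetInstance.encode
      (fun I => JudgmentAggregation.OutcomeQuestion
        (JudgmentAggregation.slater I.constraint I.profile) I.target) ∧
    JudgmentAggregation.PolyTimeDecidable JudgmentAggregation.BudgetInstance.encode
      (fun I => JudgmentAggregation.OutcomeQuestion
        (JudgmentAggregation.reversalScoring I.constraint I.profile) I.target) ∧
    JudgmentAggregation.PolyTimeDecidable JudgmentAggregation.RankedBudgetInstance.encode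
      (fun I => JudgmentAggregation.OutcomeQuestion
        (JudgmentAggregation.rankedAgenda I.tb I.constraint I.profile) I.target) := by
  exact ⟨JudgmentAggregation.polyTimeDecidable_kemeny, JudgmentAggregation.polyTimeDecidable_slater,
    JudgmentAggregation.polyTimeDecidable_reversalScoring,
    JudgmentAggregation.polyTimeDecidable_rankedAgenda⟩
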